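/- \textbf{Setting.} Fourier transforms are $\hat g(\omega)=\int g(x)e^{-i\langle\omega,x\rangle}\,dx$, extended to tempered distributions by $\langle\hat u,g\rangle=\langle u,\hat g\rangle$. Let $x^1,x^2\in\mathbb{R}^2$ be linearly independent with $x^3=x^1+x^2=(1,0)^T$, let $X=\{x^1,x^2,x^3\}$, $X^-=\{x^1,x^2,-x^3\}$, $M=[x^1\ x^2]$, and let $\alpha=(\alpha_1,\alpha_2,\alpha_3)$ with all $\alpha_k>0$; write $\boldsymbol\alpha_3=(\alpha_3,\alpha_3)^T$. The fractional cone spline $C_\alpha(\cdot\,|\,X)$ is the tempered distribution with $$\widehat{C_\alpha}(\omega\,|\,X)=\prod_{k=1}^{3}\Big(\frac1{i\langle\omega,x^k\rangle}+\sigma_k\pi\,\delta(\langle\omega,x^k\rangle)\Big)^{\alpha_k},\qquad \sigma_k=1\text{ if }\alpha_k\in\mathbb{Z}_+,\ \sigma_k=0\text{ otherwise},$$ where the product is understood as the limit in $\mathcal S'(\mathbb{R}^2)$ of $\prod_k(\varepsilon_k+i\langle\omega,x^k\rangle)^{-\alpha_k}$ as $\varepsilon_1,\varepsilon_2,\varepsilon_3\to0^+$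 independently. The fractional hex spline $B_\alpha(\cdot\,|\,X^-)$ is the tempered distribution with $$\widehat{B_\alpha}(\omega\,|\,X^-)=\big(1-e^{-i\langle\omega,x^1\rangle}\big)^{\alpha_1}\big(1-e^{-i\langle\omega,x^2\rangle}\big)^{\alpha_2}\big(e^{i\langle\omega,x^3\rangle}-1\big)^{\alpha_3}\,\widehat{C_\alpha}(\omega\,|\,X),$$ where the first two powers are principal, $(e^{i\theta}-1)^{a}:=e^{ia\theta}(1-e^{-i\theta})^{a}$ (principal power on the right), and the product with $\widehat{C_\alpha}$ is the limit in $\mathcal S'(\mathbb{R}^2)$ of the products with the above regularizations. \textbf{Proposition.} Both limits exist and define unique tempered distributions $C_\alpha(\cdot\,|\,X)$ and $B_\alpha(\cdot\,|\,X^-)$, and $$B_\alpha(x\,|\,X^-)=\sum_{k\in\mathbb{Z}^2}c_{k_1,k_2}\,C_\alpha\big(x-M(k-\boldsymbol\alpha_3)\,\big|\,X\big),\qquad c_{k_1,k_2}=\sum_{0\le\ell\le\min(k_1,k_2)}(-1)^{k_1+k_2+\ell}\binom{\alpha_1}{k_1-\ell}\binom{\alpha_2}{k_2-\ell}\binom{\alpha_3}{\ell},$$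 with generalized binomial coefficients $\binom{a}{j}=a(a-1)\cdots(a-j+1)/j!$ (an empty sum is $0$). The identity holds unconditionally in $\mathcal S'(\mathbb{R}^2)$, and also as an identity of functions, in the following sense. The distribution $C_\alpha(\cdot\,|\,X)$ is given by the function which, if $x^1_2>0$, is $$C_\alpha(x\,|\,X)=\frac1{x^1_2}\begin{cases} \dfrac{1}{\Gamma(\alpha_1)\Gamma(\alpha_2+\alpha_3)}\Big(\dfrac{x_2}{x^1_2}\Big)^{\alpha_1-1}u_+^{\alpha_2+\alpha_3-1}\,{}_2F_1\Big(1-\alpha_1,\alpha_2;\alpha_2+\alpha_3;-\dfrac{u}{x_2/x^1_2}\Big),& x_2>0,\\[2ex] \dfrac{1}{\Gamma(\alpha_2)\Gamma(\alpha_1+\alpha_3)}\Big(-\dfrac{x_2}{x^1_2}\Big)^{\alpha_2-1}v_+^{\alpha_1+\alpha_3-1}\,{}_2F_1\Big(1-\alpha_2,\alpha_1;\alpha_1+\alpha_3;\dfrac{v}{x_2/x^1_2}\Big),& x_2<0,\\[2ex] \dfrac{1}{\Gamma(\alpha_1)\Gamma(\alpha_2)}\Big(\displaystyle\sum_{k\ge0}\frac{(-1)^k}{k!\,\Gamma(\alpha_3-k)(\alpha_1+\alpha_2+k-1)}\Big)(x_1)_+^{\alpha_1+\alpha_2+\alpha_3-2},&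 x_2=0, \end{cases}$$ where $u=x_1-\frac{x^1_1}{x^1_2}x_2$, $v=x_1-\frac{x^1_1-1}{x^1_2}x_2$, $t_+^\gamma=t^\gamma$ for $t>0$ and $0$ otherwise, ${}_2F_1$ is continued to $(-\infty,1)$, and quotients with denominator $0$ (which occur only on the null set $x_2=0$) as well as $1/\Gamma$ at the poles of $\Gamma$ are read as $0$; if $x^1_2<0$ it is the same formula with $(x^1,\alpha_1)$ and $(x^2,\alpha_2)$ interchanged. For every $x$ only finitely many terms $c_{k_1,k_2}\,C_\alpha(x-M(k-\boldsymbol\alpha_3)\,|\,X)$ of the sum are nonzero, and $B_\alpha(\cdot\,|\,X^-)$ is given by the function that is their sum. (A distribution $T$ is given by a function $f$ if, for every Schwartz function $g$, $fg$ is integrable and $\langle T,g\rangle=\int fg$.) -/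

import Mathlib

open MeasureTheory Filter Topology
open scoped SchwartzMap FourierTransform RealInnerProductSpace

noncomputable section

/-! ### The Fourier transform in angular frequency -/

/-- The Fourier transform `ĝ(x) = ∫ g(ω) e^{-i⟨ω, x⟩} dω` as a continuous linear map on Schwartz
functions: Mathlib's transform (with kernel `e^{-2πi⟨ω, x⟩}`) evaluated at `x / 2π`;
see `angularFourier_apply`. -/
def angularFourier (s : ℕ) :
    𝓢(EuclideanSpace ℝ (Fin s), ℂ) →L[ℂ] 𝓢(EuclideanSpace ℝ (Fin s), ℂ) :=
  (SchwartzMap.compCLMOfContinuousLinearEquiv ℂ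
    (ContinuousLinearEquiv.smulLeft
      (Units.mk0 ((2 * Real.pi)⁻¹ : ℝ) (inv_ne_zero Real.two_pi_pos.ne')))) ∘L
    (FourierTransform.fourierCLM ℂ 𝓢(EuclideanSpace ℝ (Fin s), ℂ))

theorem angularFourier_apply {s : ℕ} (g : 𝓢(EuclideanSpace ℝ (Fin s), ℂ))
    (x : EuclideanSpace ℝ (Fin s)) :
    angularFourier s g x = ∫ ω, Complex.exp (-Complex.I * (⟪ω, x⟫ : ℝ)) * g ω := by
  have h : angularFourier s g x
      = 𝓕 (g : EuclideanSpace ℝ (Fin s) → ℂ) ((2 * Real.pi)⁻¹ • x) := rfl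
  rw [h, Real.fourier_eq']
  refine integral_congr_ae (Eventually.of_forall fun ω => ?_)
  simp only [smul_eq_mul, inner_smul_right]
  congr 2
  have := Real.pi_ne_zero
  push_cast
  field_simp

/-- The Fourier transform of a tempered distribution: `⟨û, g⟩ = ⟨u, ĝ⟩`. -/
def distFourier {s : ℕ} (u : 𝓢'(EuclideanSpace ℝ (Fin s), ℂ)) :
    𝓢'(EuclideanSpace ℝ (Fin s), ℂ) :=
  PointwiseConvergenceCLM.precomp ℂ (angularFourier s) u

theorem distFourier_apply {s : ℕ} (u : 𝓢'(EuclideanSpace ℝ (Fin s), ℂ))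
    (g : 𝓢(EuclideanSpace ℝ (Fin s), ℂ)) : distFourier u g = u (angularFourier s g) := rfl

/-- The translate `u(· - v)` of a tempered distribution: `⟨u(· - v), g⟩ = ⟨u, g(· + v)⟩`. -/
def distTranslate {s : ℕ} (v : EuclideanSpace ℝ (Fin s))
    (u : 𝓢'(EuclideanSpace ℝ (Fin s), ℂ)) : 𝓢'(EuclideanSpace ℝ (Fin s), ℂ) :=
  PointwiseConvergenceCLM.precomp ℂ (SchwartzMap.compSubConstCLM ℂ (-v)) u

theorem distTranslate_apply {s : ℕ} (v : EuclideanSpace ℝ (Fin s))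
    (u : 𝓢'(EuclideanSpace ℝ (Fin s), ℂ)) (g : 𝓢(EuclideanSpace ℝ (Fin s), ℂ)) :
    distTranslate v u g = u (g.compSubConstCLM ℂ (-v)) := rfl

/-- The tempered distribution `u` is the function `f`: for every Schwartz function `g` the
product `f g` is integrable and `⟨u, g⟩ = ∫ f g`. -/
def IsGivenByFunction {s : ℕ} (u : 𝓢'(EuclideanSpace ℝ (Fin s), ℂ))
    (f : EuclideanSpace ℝ (Fin s) → ℝ) : Prop :=
  ∀ g : 𝓢(EuclideanSpace ℝ (Fin s), ℂ),
    Integrable (fun x => (f x : ℂ) * g x) ∧ u g = ∫ x, (f x : ℂ) * g x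

/-- `û` is the limit in the space of tempered distributions of the functions `S ε`, as all the
positive parameters `ε k` tend to `0`, independently of each other. -/
def HasFourierBoundaryValue {n s : ℕ} (u : 𝓢'(EuclideanSpace ℝ (Fin s), ℂ))
    (S : (Fin n → ℝ) → EuclideanSpace ℝ (Fin s) → ℂ) : Prop :=
  ∀ g : 𝓢(EuclideanSpace ℝ (Fin s), ℂ),
    Tendsto (fun ε => ∫ ω, S ε ω * g ω) (𝓝[{ε | ∀ k, 0 < ε k}] 0) (𝓝 (distFourier u g))

/-! ### Fractional cone splines -/

/-- The regularization `(ε + iξ)^{-a}` (principal branch) of the one-dimensional distribution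
`(1/(iξ) + σ π δ(ξ))^a`, where `σ = 1` for `a ∈ {1, 2, …}` and `σ = 0` otherwise. This
distribution is the boundary value `(i(ξ - i0))^{-a}`, the Fourier transform of
`x_+^{a-1} / Γ(a)`. For `a = 1` the regularization is the Poisson integral of `1/(iξ) + π δ(ξ)`
(`coneFactor_one`); a power with a positive integer exponent `a` is the `a`-th power of the
factor for `1`; for non-integral `a` it tends to `(iξ)^{-a}`, with no `δ` term. -/
def coneFactor (a ε ξ : ℝ) : ℂ := ((ε : ℂ) + Complex.I * ξ) ^ (-a : ℂ)

/-- `1/(ε + iξ)` is the sum of the conjugate Poisson kernel, which regularizes the principal value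
`1/(iξ)`, and of `π` times the Poisson kernel, which regularizes `π δ(ξ)`. -/
theorem coneFactor_one {ε : ℝ} (hε : 0 < ε) (ξ : ℝ) :
    coneFactor 1 ε ξ = (ξ / (ξ ^ 2 + ε ^ 2) : ℝ) / Complex.I
      + Real.pi * (ε / (Real.pi * (ξ ^ 2 + ε ^ 2)) : ℝ) := by
  have h1 : (ξ : ℂ) ^ 2 + (ε : ℂ) ^ 2 ≠ 0 := by
    have : ξ ^ 2 + ε ^ 2 ≠ 0 := by positivity
    exact_mod_cast this
  have h2 : (ε : ℂ) + Complex.I * ξ ≠ 0 := fun h => by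
    have := congrArg Complex.re h
    simp at this
    exact hε.ne' this
  have h3 : (Real.pi : ℂ) ≠ 0 := by exact_mod_cast Real.pi_ne_zero
  have hI : Complex.I ^ 2 = -1 := Complex.I_sq
  unfold coneFactor
  rw [show (-((1 : ℝ) : ℂ)) = -1 by norm_num, Complex.cpow_neg_one]
  push_cast
  rw [inv_eq_iff_eq_inv, eq_comm, inv_eq_iff_eq_inv, eq_comm, inv_eq_one_div,
    Complex.div_I]
  field_simp
  linear_combination (ξ : ℂ) ^ 2 * hI

theorem coneFactor_natCast (n : ℕ) (ε ξ : ℝ) : coneFactor n ε ξ = coneFactor 1 ε ξ ^ n := by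
  unfold coneFactor
  rw [← Complex.cpow_nat_mul]
  congr 1
  push_cast
  ring

/-- The regularized product `∏_k (ε_k + i⟨ω, x^k⟩)^{-α_k}`. -/
def coneSymbol {n s : ℕ} (X : Fin n → EuclideanSpace ℝ (Fin s)) (α : Fin n → ℝ)
    (ε : Fin n → ℝ) (ω : EuclideanSpace ℝ (Fin s)) : ℂ :=
  ∏ k, coneFactor (α k) (ε k) ⟪ω, X k⟫

/-- `C` is the fractional cone spline `C_α(· | X)`: its Fourier transform is the product of the
distributions `(1/(i⟨ω, x^k⟩) + σ_k π δ(⟨ω, x^k⟩))^{α_k}`. -/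
def IsFractionalConeSpline {n s : ℕ} (X : Fin n → EuclideanSpace ℝ (Fin s)) (α : Fin n → ℝ)
    (C : 𝓢'(EuclideanSpace ℝ (Fin s), ℂ)) : Prop :=
  HasFourierBoundaryValue C (coneSymbol X α)

/-- The truncated power `x_+^γ`, equal to `x^γ` for `x > 0` and to `0` otherwise. -/
def truncPow (x γ : ℝ) : ℝ := if 0 < x then x ^ γ else 0

/-- The hypergeometric function `₂F₁(a, b; c; z)` for `c > b > 0` and real `z < 1`, by Euler's
integral (which continues the hypergeometric series beyond `|z| < 1`). -/
def hyp2F1 (a b c z : ℝ) : ℝ :=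
  Real.Gamma c / (Real.Gamma b * Real.Gamma (c - b)) *
    ∫ t in (0 : ℝ)..1, t ^ (b - 1) * (1 - t) ^ (c - b - 1) * (1 - z * t) ^ (-a)

/-- The closed form of the cone spline of order `(a₁, a₂, a₃)` on the mesh
`{p, (1,0) - p, (1,0)}` for a vector `p` with positive second coordinate. -/
def coneFormula (p : EuclideanSpace ℝ (Fin 2)) (a₁ a₂ a₃ : ℝ) (x : EuclideanSpace ℝ (Fin 2)) : ℝ :=
  1 / p 1 *
    if 0 < x 1 then
      1 / (Real.Gamma a₁ * Real.Gamma (a₂ + a₃)) * (x 1 / p 1) ^ (a₁ - 1) *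
        truncPow (x 0 - p 0 / p 1 * x 1) (a₂ + a₃ - 1) *
        hyp2F1 (1 - a₁) a₂ (a₂ + a₃) (-((x 0 - p 0 / p 1 * x 1) / (x 1 / p 1)))
    else if x 1 < 0 then
      1 / (Real.Gamma a₂ * Real.Gamma (a₁ + a₃)) * (-(x 1 / p 1)) ^ (a₂ - 1) *
        truncPow (x 0 - (p 0 - 1) / p 1 * x 1) (a₁ + a₃ - 1) *
        hyp2F1 (1 - a₂) a₁ (a₁ + a₃) ((x 0 - (p 0 - 1) / p 1 * x 1) / (x 1 / p 1))
    else
      1 / (Real.Gamma a₁ * Real.Gamma a₂) *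
        (∑' k : ℕ, (-1) ^ k / (k.factorial * Real.Gamma (a₃ - k) * (a₁ + a₂ + k - 1))) *
        truncPow (x 0) (a₁ + a₂ + a₃ - 2)

/-- The closed form of `C_α(x | X)` on a mesh with `x^3 = (1,0)`. The formula is written for
`x^1_2 > 0`; otherwise `x^2_2 = -x^1_2 > 0` and `x^1, x^2` (with their orders) change places. -/
def coneFunction (X : Fin 3 → EuclideanSpace ℝ (Fin 2)) (α : Fin 3 → ℝ)
    (x : EuclideanSpace ℝ (Fin 2)) : ℝ :=
  if 0 < X 0 1 then coneFormula (X 0) (α 0) (α 1) (α 2) x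
  else coneFormula (X 1) (α 1) (α 0) (α 2) x

/-! ### Fractional hex splines -/

/-- `X = {x^1, x^2, x^3}` is a 3-directional mesh with `x^3 = x^1 + x^2 = (1,0)`. -/
structure IsThreeDirectionalMesh (X : Fin 3 → EuclideanSpace ℝ (Fin 2)) : Prop where
  linearIndependent : LinearIndependent ℝ ![X 0, X 1]
  third_eq_add : X 2 = X 0 + X 1
  third_eq : X 2 = !₂[1, 0]

/-- The function `(1 - e^{-i⟨ω,x^1⟩})^{α₁} (1 - e^{-i⟨ω,x^2⟩})^{α₂} (e^{i⟨ω,x^3⟩} - 1)^{α₃}`.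
The first two powers are principal. The third is the branch
`(e^{iθ} - 1)^a = e^{iaθ} (1 - e^{-iθ})^a`, which is continuous in `θ ∈ ℝ`, is the principal power
for `|θ| < π`, and extends holomorphically to the lower half-plane. -/
def hexMultiplier (X : Fin 3 → EuclideanSpace ℝ (Fin 2)) (α : Fin 3 → ℝ)
    (ω : EuclideanSpace ℝ (Fin 2)) : ℂ :=
  (1 - Complex.exp (-Complex.I * (⟪ω, X 0⟫ : ℝ))) ^ (α 0 : ℂ) *
  (1 - Complex.exp (-Complex.I * (⟪ω, X 1⟫ : ℝ))) ^ (α 1 : ℂ) *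
  (Complex.exp (Complex.I * α 2 * (⟪ω, X 2⟫ : ℝ)) *
    (1 - Complex.exp (-Complex.I * (⟪ω, X 2⟫ : ℝ))) ^ (α 2 : ℂ))

/-- `B` is the fractional hex spline `B_α(· | X⁻)`: its Fourier transform is the product of
`hexMultiplier X α` and the Fourier transform of the fractional cone spline. The multiplier is
continuous but in general not smooth, so the product with the distribution is taken through the
regularizations of the latter. -/
def IsFractionalHexSpline (X : Fin 3 → EuclideanSpace ℝ (Fin 2)) (α : Fin 3 → ℝ)
    (B : 𝓢'(EuclideanSpace ℝ (Fin 2), ℂ)) : Prop :=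
  HasFourierBoundaryValue B (fun ε ω => hexMultiplier X α ω * coneSymbol X α ε ω)

/-- The generalized binomial coefficient `a (a-1) ⋯ (a-j+1) / j!`, equal to `0` for `j < 0`. -/
def genBinom (a : ℝ) (j : ℤ) : ℝ := if 0 ≤ j then Ring.choose a j.toNat else 0

/-- The coefficient `c_{k₁,k₂}`; only the terms with `ℓ ≤ min(k₁, k₂)` can be nonzero. -/
def hexCoeff (α : Fin 3 → ℝ) (k : ℤ × ℤ) : ℝ :=
  ∑' ℓ : ℕ, genBinom (α 0) (k.1 - ℓ) * genBinom (α 1) (k.2 - ℓ) * genBinom (α 2) ℓ *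
    (-1 : ℝ) ^ (k.1 + k.2 + ℓ)

/-- The point `M (k - (α₃, α₃)ᵀ)` for the matrix `M = [x^1 x^2]`. -/
def hexShift (X : Fin 3 → EuclideanSpace ℝ (Fin 2)) (α : Fin 3 → ℝ) (k : ℤ × ℤ) :
    EuclideanSpace ℝ (Fin 2) :=
  ((k.1 : ℝ) - α 2) • X 0 + ((k.2 : ℝ) - α 2) • X 1

end

/-! For a positive order `a`, `(ε + iξ)^{-a}` is the Laplace transform of `t_+^{a-1} / Γ(a)` at `ε +
iξ` (`integral_coneWeight_mul_cexp`). The regularized symbol is therefore the Fourier transform of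
the image, under `t ↦ t₁x¹ + t₂x² + t₃x³`, of a product density damped by `e^{-ε·t}`
(`integral_coneDensity_mul_cexp_inner`, `integral_coneSymbol_mul`). The cone is pointed, so a
Schwartz function at the image point decays in every `t_k` (`exists_dominating`). Dominated
convergence removes the damping, and the cone spline is the image of the undamped density.

Since the orders are positive, the binomial series of the three powers converge absolutely on the
unit circle. The relation `x³ = x¹ + x²` regroups their product as an absolutely convergent sum of
`c_k e^{-i⟨ω, M(k - α₃)⟩}` (`hasSum_hexMultiplier`), and each exponential translates the cone
spline. Coefficients vanish unless `k ≥ 0`, so all relevant shifts lie in one translate of the cone.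
There the Schwartz bounds are uniform, and the series commutes with the integrals and with the limit
`ε → 0`.

For the identity of functions, the fibres of the map above are lines of direction `(1, 1, -1)`.
Integrating along them gives `fibreIntegral`, which rescales to Euler's integral for `₂F₁`. The
support of the cone spline leaves finitely many terms at each point, and its nonnegativity turns the
bounds already found into bounds on the `L¹` norms of the terms. -/

/-! ### Binomial series on the closed unit disc -/

theorem Ring.choose_succ_mul (a : ℝ) (n : ℕ) :
    Ring.choose a (n + 1) * (n + 1) = Ring.choose a n * (a - n) := by
  have h : ((n.factorial : ℝ)) ≠ 0 := by positivity
  have h2 : ((n : ℝ) + 1) ≠ 0 := by positivity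
  rw [Ring.choose_eq_smul, Ring.choose_eq_smul, descPochhammer_succ_right,
    Polynomial.smeval_mul, Nat.factorial_succ]
  simp only [Polynomial.smeval_sub, Polynomial.smeval_X, Polynomial.smeval_natCast, smul_eq_mul]
  push_cast
  simp
  field_simp

/-- The binomial coefficients of a positive order are absolutely summable. -/
theorem summable_abs_choose {a : ℝ} (ha : 0 < a) : Summable fun n : ℕ => |Ring.choose a n| := by
  obtain ⟨N, hN⟩ := exists_nat_ge a
  rw [← summable_nat_add_iff N]
  -- Past `N ≥ a` the recursion reads `(n+1)|c_{n+1}| = (n-a)|c_n|`, so `a|c_n|` telescopes.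
  have key : ∀ n : ℕ, a * |Ring.choose a (n + N)| =
      (n + N : ℕ) * |Ring.choose a (n + N)| - (n + 1 + N : ℕ) * |Ring.choose a (n + 1 + N)| := by
    intro n
    have h := Ring.choose_succ_mul a (n + N)
    have h1 := congrArg abs h
    rw [abs_mul, abs_mul, abs_of_nonneg (by positivity : (0 : ℝ) ≤ ((n + N : ℕ) : ℝ) + 1),
      abs_sub_comm, abs_of_nonneg
        (by push_cast; linarith [(n.cast_nonneg : (0 : ℝ) ≤ n)] : (0 : ℝ) ≤ (n + N : ℕ) - a)] at h1
    rw [show n + 1 + N = n + N + 1 by ring]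
    push_cast at h1 ⊢
    linarith
  have hsum : ∀ m : ℕ, ∑ i ∈ Finset.range m, a * |Ring.choose a (i + N)| ≤
      (N : ℝ) * |Ring.choose a N| := by
    intro m
    simp_rw [key]
    rw [Finset.sum_range_sub' (fun i : ℕ => ((i + N : ℕ) : ℝ) * |Ring.choose a (i + N)|)]
    simp
    positivity
  have : Summable fun n : ℕ => a * |Ring.choose a (n + N)| :=
    summable_of_sum_range_le (fun n => by positivity) hsum
  exact (summable_mul_left_iff ha.ne').1 this

theorem hasSum_one_sub_cpow_of_lt (a : ℝ) {w : ℂ} (hw : ‖w‖ < 1) :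
    HasSum (fun n : ℕ => ((-1) ^ n * (Ring.choose a n : ℝ) : ℂ) * w ^ n) ((1 - w) ^ (a : ℂ)) := by
  have h := (Complex.one_add_cpow_hasFPowerSeriesOnBall_zero (a := (a : ℂ))).hasSum
    (y := -w) (by
      rw [← ENNReal.ofReal_one, Metric.eball_ofReal]
      simpa using hw)
  simp only [binomialSeries_apply, List.ofFn_const, List.prod_replicate, smul_eq_mul,
    ← sub_eq_add_neg, neg_pow w] at h
  rw [sub_eq_add_neg, ← zero_sub w]
  refine Eq.mp (congrArg (fun f : ℕ → ℂ => HasSum f _) (funext fun n => ?_)) h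
  rw [Complex.ofReal_choose]
  ring

/-- The binomial series of a positive order converges on the closed unit disc. -/
theorem hasSum_one_sub_cpow {a : ℝ} (ha : 0 < a) {w : ℂ} (hw : ‖w‖ ≤ 1) :
    HasSum (fun n : ℕ => ((-1) ^ n * (Ring.choose a n : ℝ) : ℂ) * w ^ n) ((1 - w) ^ (a : ℂ)) := by
  have hbound : ∀ (n : ℕ) (z : ℂ), z ∈ Metric.closedBall (0 : ℂ) 1 →
      ‖((-1) ^ n * (Ring.choose a n : ℝ) : ℂ) * z ^ n‖ ≤ |Ring.choose a n| := by
    intro n z hz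
    rw [norm_mul, norm_mul, norm_pow, norm_pow, norm_neg, norm_one, one_pow, one_mul,
      Complex.norm_real, Real.norm_eq_abs]
    exact mul_le_of_le_one_right (abs_nonneg _) (pow_le_one₀ (norm_nonneg _) (by simpa using hz))
  have hs : Summable (fun n : ℕ => ((-1) ^ n * (Ring.choose a n : ℝ) : ℂ) * w ^ n) :=
    Summable.of_norm_bounded (summable_abs_choose ha) fun n => hbound n w (by simpa using hw)
  have hc : ContinuousOn (fun z : ℂ => ∑' n : ℕ, ((-1) ^ n * (Ring.choose a n : ℝ) : ℂ) * z ^ n)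
      (Metric.closedBall 0 1) :=
    continuousOn_tsum (fun n => by fun_prop) (summable_abs_choose ha) hbound
  have hr : ∀ᶠ r in 𝓝[<] (1 : ℝ), r ∈ Set.Ioo (0 : ℝ) 1 := Ioo_mem_nhdsLT one_pos
  have hmul : Tendsto (fun r : ℝ => (r : ℂ) * w) (𝓝[<] (1 : ℝ)) (𝓝 w) := by
    have : Tendsto (fun r : ℝ => (r : ℂ) * w) (𝓝 (1 : ℝ)) (𝓝 (((1 : ℝ) : ℂ) * w)) :=
      Continuous.tendsto (by fun_prop) _
    simpa using this.mono_left nhdsWithin_le_nhds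
  have hnorm : ∀ r ∈ Set.Ioo (0 : ℝ) 1, ‖(r : ℂ) * w‖ < 1 := by
    intro r hr
    rw [norm_mul, Complex.norm_real, Real.norm_of_nonneg hr.1.le]
    nlinarith [hr.1, hr.2, norm_nonneg w]
  -- Abel's argument: both sides are followed along the radius `r w`, `r → 1⁻`. The series is
  -- continuous on the closed disc by uniform convergence. The power is continuous because `1 - w`
  -- has positive real part unless `w = 1`, where `a > 0` is needed.
  have h1 : Tendsto (fun r : ℝ => ∑' n : ℕ, ((-1) ^ n * (Ring.choose a n : ℝ) : ℂ) * (r * w) ^ n)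
      (𝓝[<] (1 : ℝ)) (𝓝 (∑' n : ℕ, ((-1) ^ n * (Ring.choose a n : ℝ) : ℂ) * w ^ n)) := by
    refine (hc w (by simpa using hw)).tendsto.comp
      (tendsto_nhdsWithin_iff.2 ⟨hmul, hr.mono fun r h => ?_⟩)
    simpa using (hnorm r h).le
  have h2 : Tendsto (fun r : ℝ => (1 - (r : ℂ) * w) ^ (a : ℂ)) (𝓝[<] (1 : ℝ))
      (𝓝 ((1 - w) ^ (a : ℂ))) := by
    have hca : ContinuousAt (fun z : ℂ => z ^ (a : ℂ)) (1 - w) := by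
      by_cases h0 : w = 1
      · rw [h0, sub_self]
        exact Complex.continuousAt_cpow_zero_of_re_pos (z := (a : ℂ)) (by simpa using ha) |>.comp
          (f := fun z : ℂ => (z, (a : ℂ))) (x := 0) (by fun_prop)
      · refine continuousAt_cpow_const (Or.inl ?_)
        have : w.re < 1 := by
          refine lt_of_le_of_ne ((Complex.re_le_norm w).trans hw) fun h => h0 ?_
          have h3 := Complex.sq_norm w
          rw [Complex.normSq_apply, h] at h3
          have h4 : w.im = 0 := by nlinarith [norm_nonneg w, sq_nonneg w.im]
          exact Complex.ext h h4
        simpa using this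
    exact hca.tendsto.comp (tendsto_const_nhds.sub hmul)
  have heq : ∑' n : ℕ, ((-1) ^ n * (Ring.choose a n : ℝ) : ℂ) * w ^ n = (1 - w) ^ (a : ℂ) := by
    refine tendsto_nhds_unique (h1.congr' (hr.mono fun r h => ?_)) h2
    exact (hasSum_one_sub_cpow_of_lt a (hnorm r h)).tsum_eq
  exact heq ▸ hs.hasSum

/-! ### The coefficients and the Fourier series of the multiplier -/

theorem norm_exp_neg_I_mul (x : ℝ) : ‖Complex.exp (-Complex.I * x)‖ = 1 := by
  rw [show -Complex.I * (x : ℂ) = ((-x : ℝ) : ℂ) * Complex.I by push_cast; ring]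
  exact Complex.norm_exp_ofReal_mul_I _

/-- The summands of `hexCoeff α k`, as a function of `k` and `ℓ`. -/
noncomputable def hexTerm (α : Fin 3 → ℝ) (q : (ℤ × ℤ) × ℕ) : ℝ :=
  genBinom (α 0) (q.1.1 - q.2) * genBinom (α 1) (q.1.2 - q.2) * genBinom (α 2) q.2 *
    (-1 : ℝ) ^ (q.1.1 + q.1.2 + q.2)

/-- The change of indices `k = (j₁ + ℓ, j₂ + ℓ)`. -/
def hexIndex (j : ℕ × ℕ × ℕ) : (ℤ × ℤ) × ℕ := ((j.1 + j.2.2, j.2.1 + j.2.2), j.2.2)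

theorem hexIndex_injective : Function.Injective hexIndex := by
  rintro ⟨a, b, c⟩ ⟨a', b', c'⟩ h
  simp only [hexIndex, Prod.mk.injEq] at h ⊢
  omega

theorem hexTerm_eq_zero {α : Fin 3 → ℝ} {q : (ℤ × ℤ) × ℕ} (hq : q ∉ Set.range hexIndex) :
    hexTerm α q = 0 := by
  obtain ⟨⟨k₁, k₂⟩, l⟩ := q
  by_cases h1 : 0 ≤ k₁ - l
  · by_cases h2 : 0 ≤ k₂ - l
    · refine absurd ⟨((k₁ - l).toNat, (k₂ - l).toNat, l), ?_⟩ hq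
      simp only [hexIndex, Int.toNat_of_nonneg h1, Int.toNat_of_nonneg h2, sub_add_cancel]
    · simp only [hexTerm, genBinom, if_neg h2, mul_zero, zero_mul]
  · simp only [hexTerm, genBinom, if_neg h1, zero_mul]

theorem hexTerm_hexIndex (α : Fin 3 → ℝ) (j : ℕ × ℕ × ℕ) :
    hexTerm α (hexIndex j) = ((-1) ^ j.1 * Ring.choose (α 0) j.1) *
      (((-1) ^ j.2.1 * Ring.choose (α 1) j.2.1) * ((-1) ^ j.2.2 * Ring.choose (α 2) j.2.2)) := by
  obtain ⟨a, b, c⟩ := j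
  have h : ((-1 : ℝ)) ^ ((a + c : ℤ) + (b + c : ℤ) + (c : ℤ)) = (-1) ^ a * ((-1) ^ b * (-1) ^ c) := by
    rw [show ((a + c : ℤ) + (b + c : ℤ) + (c : ℤ)) = ((a + b + c + 2 * c : ℕ) : ℤ) by
      push_cast; ring, zpow_natCast, pow_add, pow_add, pow_add, pow_mul]
    norm_num
    ring
  simp only [hexTerm, hexIndex, genBinom, add_sub_cancel_right, Nat.cast_nonneg, if_true,
    Int.toNat_natCast, h]
  ring

theorem summable_abs_hexTerm {α : Fin 3 → ℝ} (hα : ∀ k, 0 < α k) :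
    Summable fun q => |hexTerm α q| := by
  have hinj := hexIndex_injective
  rw [← hinj.summable_iff (fun q hq => by rw [hexTerm_eq_zero hq, abs_zero])]
  have h12 := (summable_abs_choose (hα 1)).mul_of_nonneg (summable_abs_choose (hα 2))
    (fun _ => abs_nonneg _) (fun _ => abs_nonneg _)
  have h := (summable_abs_choose (hα 0)).mul_of_nonneg h12
    (fun _ => abs_nonneg _) (fun _ => by positivity)
  refine h.congr fun j => ?_
  simp [hexTerm_hexIndex, abs_mul]

theorem hexCoeff_eq_tsum (α : Fin 3 → ℝ) (k : ℤ × ℤ) : hexCoeff α k = ∑' l, hexTerm α (k, l) := rfl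

theorem summable_abs_hexCoeff {α : Fin 3 → ℝ} (hα : ∀ k, 0 < α k) :
    Summable fun k => |hexCoeff α k| := by
  have h := summable_abs_hexTerm hα
  refine Summable.of_nonneg_of_le (fun _ => abs_nonneg _) (fun k => ?_) h.prod
  have := norm_tsum_le_tsum_norm (f := fun l => hexTerm α (k, l)) (h.prod_factor k)
  simpa [hexCoeff_eq_tsum] using this

theorem nonneg_of_hexCoeff_ne_zero {α : Fin 3 → ℝ} {k : ℤ × ℤ} (h : hexCoeff α k ≠ 0) :
    0 ≤ k.1 ∧ 0 ≤ k.2 := by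
  by_contra hk
  refine h ?_
  rw [hexCoeff_eq_tsum]
  refine (tsum_congr fun l => hexTerm_eq_zero ?_).trans tsum_zero
  rintro ⟨⟨a, b, c⟩, hj⟩
  simp only [hexIndex, Prod.mk.injEq] at hj
  rw [← hj.1] at hk
  exact hk ⟨by positivity, by positivity⟩

theorem HasSum.mul_of_summable_norm {ι κ : Type*} {f : ι → ℂ} {g : κ → ℂ} {a b : ℂ}
    (hf : HasSum f a) (hg : HasSum g b) (hf' : Summable fun i => ‖f i‖)
    (hg' : Summable fun i => ‖g i‖) : HasSum (fun j : ι × κ => f j.1 * g j.2) (a * b) :=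
  hf.mul hg (summable_mul_of_summable_norm hf' hg')

theorem hasSum_hexTerm_hexIndex {α : Fin 3 → ℝ} (hα : ∀ k, 0 < α k) {w : Fin 3 → ℂ}
    (hw : ∀ i, ‖w i‖ = 1) :
    HasSum (fun j : ℕ × ℕ × ℕ => (hexTerm α (hexIndex j) : ℂ) *
        (w 0 ^ j.1 * (w 1 ^ j.2.1 * w 2 ^ j.2.2)))
      ((1 - w 0) ^ (α 0 : ℂ) * ((1 - w 1) ^ (α 1 : ℂ) * (1 - w 2) ^ (α 2 : ℂ))) := by
  set u : Fin 3 → ℕ → ℂ := fun i n => ((-1) ^ n * (Ring.choose (α i) n : ℝ) : ℂ) * w i ^ n with hu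
  have hs : ∀ i, Summable fun n : ℕ => ‖u i n‖ := by
    intro i
    refine (summable_abs_choose (hα i)).congr fun n => ?_
    rw [hu, norm_mul, norm_pow (w i), hw]
    simp
  have hb : ∀ i, HasSum (u i) ((1 - w i) ^ (α i : ℂ)) :=
    fun i => hasSum_one_sub_cpow (hα i) (hw i).le
  clear_value u
  have h := (hb 0).mul_of_summable_norm (g := fun j : ℕ × ℕ => u 1 j.1 * u 2 j.2)
    ((hb 1).mul_of_summable_norm (hb 2) (hs 1) (hs 2)) (hs 0) ((hs 1).mul_norm (hs 2))
  refine Eq.mp (congrArg (fun f : ℕ × ℕ × ℕ → ℂ => HasSum f _) (funext fun j => ?_)) h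
  rw [hexTerm_hexIndex, hu]
  push_cast
  ring

/-- Since `x³ = x¹ + x²`, the index `ℓ` is absorbed into both lattice coordinates, and the shift by
`-α₃(x¹ + x²)` produces the phase that separates `(e^{iθ} - 1)^{α₃}` from `(1 - e^{-iθ})^{α₃}`. -/
theorem exp_inner_hexShift {X : Fin 3 → EuclideanSpace ℝ (Fin 2)} (hX : X 2 = X 0 + X 1)
    (α : Fin 3 → ℝ) (ω : EuclideanSpace ℝ (Fin 2)) (j : ℕ × ℕ × ℕ) :
    Complex.exp (-Complex.I * (⟪ω, hexShift X α (hexIndex j).1⟫ : ℝ)) =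
      (Complex.exp (-Complex.I * (⟪ω, X 0⟫ : ℝ)) ^ j.1 *
        (Complex.exp (-Complex.I * (⟪ω, X 1⟫ : ℝ)) ^ j.2.1 *
          Complex.exp (-Complex.I * (⟪ω, X 2⟫ : ℝ)) ^ j.2.2)) *
        Complex.exp (Complex.I * α 2 * (⟪ω, X 2⟫ : ℝ)) := by
  rw [← Complex.exp_nat_mul, ← Complex.exp_nat_mul, ← Complex.exp_nat_mul, ← Complex.exp_add,
    ← Complex.exp_add, ← Complex.exp_add]
  congr 1
  simp only [hexShift, hexIndex, hX, inner_add_right, inner_smul_right]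
  push_cast
  ring

/-- The Fourier expansion of the multiplier of the hex spline. -/
theorem hasSum_hexMultiplier {X : Fin 3 → EuclideanSpace ℝ (Fin 2)} {α : Fin 3 → ℝ}
    (hX : X 2 = X 0 + X 1) (hα : ∀ k, 0 < α k) (ω : EuclideanSpace ℝ (Fin 2)) :
    HasSum (fun k => (hexCoeff α k : ℂ) *
      Complex.exp (-Complex.I * (⟪ω, hexShift X α k⟫ : ℝ))) (hexMultiplier X α ω) := by
  have h := (hasSum_hexTerm_hexIndex hα
    (w := fun i => Complex.exp (-Complex.I * (⟪ω, X i⟫ : ℝ)))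
    (fun i => norm_exp_neg_I_mul _)).mul_right (Complex.exp (Complex.I * α 2 * (⟪ω, X 2⟫ : ℝ)))
  have hv : (1 - Complex.exp (-Complex.I * (⟪ω, X 0⟫ : ℝ))) ^ (α 0 : ℂ) *
      ((1 - Complex.exp (-Complex.I * (⟪ω, X 1⟫ : ℝ))) ^ (α 1 : ℂ) *
        (1 - Complex.exp (-Complex.I * (⟪ω, X 2⟫ : ℝ))) ^ (α 2 : ℂ)) *
      Complex.exp (Complex.I * α 2 * (⟪ω, X 2⟫ : ℝ)) = hexMultiplier X α ω := by
    rw [hexMultiplier]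
    ring
  rw [hv] at h
  have hsum : HasSum (fun q : (ℤ × ℤ) × ℕ => (hexTerm α q : ℂ) *
      Complex.exp (-Complex.I * (⟪ω, hexShift X α q.1⟫ : ℝ))) (hexMultiplier X α ω) := by
    rw [← hexIndex_injective.hasSum_iff
      (fun q hq => by rw [hexTerm_eq_zero hq, Complex.ofReal_zero, zero_mul])]
    refine Eq.mp (congrArg (fun f : ℕ × ℕ × ℕ → ℂ => HasSum f _) (funext fun j => ?_)) h
    rw [Function.comp_apply, exp_inner_hexShift hX, mul_assoc]
  refine hsum.prod_fiberwise fun k => ?_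
  have := ((summable_abs_hexTerm hα).prod_factor k).of_abs.hasSum
  exact (Complex.hasSum_ofReal.2 this).mul_right _

/-! ### One-dimensional densities and their Laplace transforms -/

/-- The density `t_+^{a-1} / Γ(a)` of the one-dimensional cone spline of order `a`. -/
noncomputable def coneWeight (a t : ℝ) : ℝ := truncPow t (a - 1) / Real.Gamma a

theorem measurable_coneWeight (a : ℝ) : Measurable (coneWeight a) := by
  unfold coneWeight truncPow
  exact (Measurable.ite measurableSet_Ioi (by fun_prop) measurable_const).div_const _

theorem coneWeight_nonneg {a : ℝ} (ha : 0 < a) (t : ℝ) : 0 ≤ coneWeight a t := by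
  unfold coneWeight truncPow
  refine div_nonneg ?_ (Real.Gamma_pos_of_pos ha).le
  split_ifs with h
  · exact Real.rpow_nonneg h.le _
  · exact le_rfl

theorem coneWeight_of_nonpos {a t : ℝ} (ht : t ≤ 0) : coneWeight a t = 0 := by
  simp [coneWeight, truncPow, ht.not_gt]

theorem coneWeight_of_pos {a t : ℝ} (ht : 0 < t) :
    coneWeight a t = t ^ (a - 1) / Real.Gamma a := by
  simp [coneWeight, truncPow, ht]

theorem coneWeight_mul_eq_indicator {V : Type*} [AddCommGroup V] [Module ℝ V] (a : ℝ) (f : ℝ → V) :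
    (fun t => coneWeight a t • f t) =
      (Set.Ioi 0).indicator fun t => (Real.Gamma a)⁻¹ • t ^ (a - 1) • f t := by
  funext t
  by_cases ht : 0 < t
  · rw [Set.indicator_of_mem (show t ∈ Set.Ioi 0 from ht), coneWeight_of_pos ht, smul_smul, div_eq_inv_mul]
  · rw [Set.indicator_of_notMem (show t ∉ Set.Ioi 0 from ht), coneWeight_of_nonpos (not_lt.1 ht), zero_smul]

theorem integrable_coneWeight_mul_exp {a r : ℝ} (ha : 0 < a) (hr : 0 < r) :
    Integrable fun t => coneWeight a t * Real.exp (-(r * t)) := by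
  have h := integrableOn_rpow_mul_exp_neg_mul_rpow (s := a - 1) (p := 1) (b := r) (by linarith)
    one_pos hr
  have := coneWeight_mul_eq_indicator a fun t => Real.exp (-(r * t))
  simp only [smul_eq_mul] at this
  rw [this, integrable_indicator_iff measurableSet_Ioi]
  refine Integrable.const_mul (h.congr_fun (fun t _ => ?_) measurableSet_Ioi) _
  simp

theorem integral_coneWeight_mul_exp_of_pos {a r : ℝ} (ha : 0 < a) (hr : 0 < r) :
    ∫ t, coneWeight a t * Real.exp (-(r * t)) = r ^ (-a) := by
  have := coneWeight_mul_eq_indicator a fun t => Real.exp (-(r * t))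
  simp only [smul_eq_mul] at this
  rw [this, integral_indicator measurableSet_Ioi, integral_const_mul,
    Real.integral_rpow_mul_exp_neg_mul_Ioi ha hr, one_div, Real.inv_rpow hr.le,
    Real.rpow_neg hr.le]
  have := (Real.Gamma_pos_of_pos ha).ne'
  field_simp

/-- Comparison with `t^{a-1}` on `(0, 1]` and with `t^{a-1-m}` beyond `1`. -/
theorem integrable_coneWeight_mul_one_add_pow {a : ℝ} (ha : 0 < a) {m : ℕ} (hm : a < m) :
    Integrable fun t => coneWeight a t * ((1 + |t|) ^ m)⁻¹ := by
  have h0 : IntegrableOn (fun t : ℝ => t ^ (a - 1)) (Set.Ioc 0 1) := by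
    have := intervalIntegral.intervalIntegrable_rpow' (a := 0) (b := 1) (r := a - 1) (by linarith)
    rwa [intervalIntegrable_iff_integrableOn_Ioc_of_le zero_le_one] at this
  have h1 : IntegrableOn (fun t : ℝ => t ^ (a - 1 - m)) (Set.Ioi 1) :=
    integrableOn_Ioi_rpow_of_lt (by linarith) one_pos
  have hg := ((h0.integrable_indicator measurableSet_Ioc).add
    (h1.integrable_indicator measurableSet_Ioi)).const_mul (Real.Gamma a)⁻¹
  have hΓ := Real.Gamma_pos_of_pos ha
  refine hg.mono' ((measurable_coneWeight a).mul (by fun_prop)).aestronglyMeasurable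
    (Eventually.of_forall fun t => ?_)
  rw [Real.norm_of_nonneg (mul_nonneg (coneWeight_nonneg ha t) (by positivity))]
  rcases le_or_gt t 0 with ht | ht
  · simp [coneWeight_of_nonpos ht, (ht.trans zero_le_one), ht.not_gt]
  rw [coneWeight_of_pos ht, div_eq_inv_mul, mul_assoc, abs_of_pos ht]
  refine mul_le_mul_of_nonneg_left ?_ (by positivity)
  have hp := Real.rpow_nonneg ht.le (a - 1)
  by_cases h : t ≤ 1
  · simp only [Pi.add_apply]
    rw [Set.indicator_of_mem (show t ∈ Set.Ioc 0 1 from ⟨ht, h⟩),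
      Set.indicator_of_notMem (by simpa using h), add_zero]
    exact mul_le_of_le_one_right hp (inv_le_one_of_one_le₀ (one_le_pow₀ (by linarith)))
  · simp only [Pi.add_apply]
    rw [Set.indicator_of_notMem (by simp [h]),
      Set.indicator_of_mem (show t ∈ Set.Ioi 1 from not_le.1 h), zero_add,
      Real.rpow_sub ht (a - 1), Real.rpow_natCast, div_eq_mul_inv]
    gcongr
    linarith

/-- The Laplace transform of `t_+^{a-1} / Γ(a)` in the right half-plane. -/
theorem integral_coneWeight_mul_cexp {a : ℝ} (ha : 0 < a) {z : ℂ} (hz : 0 < z.re) :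
    ∫ t, (coneWeight a t : ℂ) * Complex.exp (-(z * t)) = z ^ (-a : ℂ) := by
  -- The integral is read as the complex moment generating function of this measure at `-z`, which
  -- is analytic in the left half-plane. It agrees with `(-w)^{-a}` on the negative reals, hence
  -- everywhere there by the identity theorem.
  set μ : Measure ℝ := volume.withDensity fun t => ENNReal.ofReal (coneWeight a t) with hμ
  have hmeas : Measurable fun t => ENNReal.ofReal (coneWeight a t) :=
    (measurable_coneWeight a).ennreal_ofReal
  have hlt : ∀ᵐ t : ℝ, ENNReal.ofReal (coneWeight a t) < ⊤ :=
    Eventually.of_forall fun _ => ENNReal.ofReal_lt_top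
  have hset : Set.Iio 0 ⊆ ProbabilityTheory.integrableExpSet id μ := by
    intro r hr
    change Integrable (fun t => Real.exp (r * t)) μ
    rw [hμ, integrable_withDensity_iff_integrable_smul' hmeas hlt]
    refine (integrable_coneWeight_mul_exp ha (neg_pos.2 hr)).congr (Eventually.of_forall fun t => ?_)
    simp [ENNReal.toReal_ofReal (coneWeight_nonneg ha t)]
  have hmgf : ∀ w : ℂ, ProbabilityTheory.complexMGF id μ w =
      ∫ t, (coneWeight a t : ℂ) * Complex.exp (w * t) := by
    intro w
    rw [ProbabilityTheory.complexMGF, hμ, integral_withDensity_eq_integral_toReal_smul hmeas hlt]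
    refine integral_congr_ae (Eventually.of_forall fun t => ?_)
    simp [ENNReal.toReal_ofReal (coneWeight_nonneg ha t)]
  have hU : {w : ℂ | w.re < 0} ⊆
      {w : ℂ | w.re ∈ interior (ProbabilityTheory.integrableExpSet id μ)} := fun w hw =>
    interior_maximal hset isOpen_Iio hw
  have han1 := (ProbabilityTheory.analyticOnNhd_complexMGF (X := id) (μ := μ)).mono hU
  have hopen : IsOpen {w : ℂ | w.re < 0} := isOpen_lt Complex.continuous_re continuous_const
  have han2 : AnalyticOnNhd ℂ (fun w : ℂ => (-w) ^ (-a : ℂ)) {w : ℂ | w.re < 0} := by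
    refine DifferentiableOn.analyticOnNhd (fun w hw => ?_) hopen
    refine (DifferentiableAt.cpow_const (by fun_prop) (Or.inl ?_)).differentiableWithinAt
    simpa using hw
  have hpre : IsPreconnected {w : ℂ | w.re < 0} := (convex_halfSpace_re_lt 0).isPreconnected
  have hreal : ∀ r : ℝ, r < 0 → ProbabilityTheory.complexMGF id μ r = (-(r : ℂ)) ^ (-a : ℂ) := by
    intro r hr
    rw [hmgf]
    have h := integral_coneWeight_mul_exp_of_pos ha (neg_pos.2 hr)
    have h' := congrArg (fun x : ℝ => (x : ℂ)) h
    simp only [Complex.ofReal_cpow (neg_pos.2 hr).le] at h'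
    rw [← integral_complex_ofReal] at h'
    push_cast at h'
    simpa using h'
  have hfreq : ∃ᶠ w in 𝓝[≠] (-1 : ℂ),
      ProbabilityTheory.complexMGF id μ w = (-w) ^ (-a : ℂ) := by
    have hT : Tendsto (fun r : ℝ => (r : ℂ)) (𝓝[<] (-1 : ℝ)) (𝓝[≠] (-1 : ℂ)) := by
      refine tendsto_nhdsWithin_iff.2 ⟨?_, ?_⟩
      · have : Tendsto (fun r : ℝ => (r : ℂ)) (𝓝 (-1 : ℝ)) (𝓝 ((-1 : ℝ) : ℂ)) :=
          Complex.continuous_ofReal.tendsto _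
        simpa using this.mono_left nhdsWithin_le_nhds
      · filter_upwards [self_mem_nhdsWithin] with r hr h
        have : r = -1 := by exact_mod_cast (show (r : ℂ) = ((-1 : ℝ) : ℂ) by simpa using h)
        exact (ne_of_lt hr) this
    refine hT.frequently (Eventually.frequently ?_)
    filter_upwards [self_mem_nhdsWithin] with r hr
    exact hreal r (lt_trans hr (by norm_num))
  have heq := han1.eqOn_of_preconnected_of_frequently_eq han2 hpre (z₀ := -1) (by simp) hfreq
  have := heq (show -z ∈ {w : ℂ | w.re < 0} by simpa using hz)
  simp only [hmgf, neg_neg] at this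
  simpa only [neg_mul] using this

/-! ### Geometry of the mesh and uniform bounds on the cone -/

theorem IsThreeDirectionalMesh.snd_eq {X : Fin 3 → EuclideanSpace ℝ (Fin 2)}
    (hX : IsThreeDirectionalMesh X) : X 1 0 = 1 - X 0 0 ∧ X 1 1 = - X 0 1 := by
  have h := hX.third_eq_add
  rw [hX.third_eq] at h
  have h0 := congrArg (fun x : EuclideanSpace ℝ (Fin 2) => x 0) h
  have h1 := congrArg (fun x : EuclideanSpace ℝ (Fin 2) => x 1) h
  simp at h0 h1
  constructor <;> linarith

theorem IsThreeDirectionalMesh.apply_zero_one_ne_zero {X : Fin 3 → EuclideanSpace ℝ (Fin 2)}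
    (hX : IsThreeDirectionalMesh X) : X 0 1 ≠ 0 := by
  intro h
  obtain ⟨h0, h1⟩ := hX.snd_eq
  -- If both vectors lay on the horizontal axis, this relation would make both first coordinates
  -- zero, but they add up to `1`.
  have := LinearIndependent.pair_iff.1 hX.linearIndependent (X 1 0) (-X 0 0) (by
    ext i
    fin_cases i
    · simp; ring
    · simp [h, h1])
  linarith [this.1, this.2]

/-- The density `∏_k (t_k)_+^{a_k-1} / Γ(a_k)`, at the point `t = (t₂, (t₁, t₃))`. -/
noncomputable def coneDensity (α : Fin 3 → ℝ) (t : ℝ × ℝ × ℝ) : ℝ :=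
  coneWeight (α 1) t.1 * (coneWeight (α 0) t.2.1 * coneWeight (α 2) t.2.2)

/-- The point `t₁ x¹ + t₂ x² + t₃ x³`, where `t = (t₂, (t₁, t₃))`. -/
noncomputable def conePoint (X : Fin 3 → EuclideanSpace ℝ (Fin 2)) (t : ℝ × ℝ × ℝ) :
    EuclideanSpace ℝ (Fin 2) :=
  t.2.1 • X 0 + t.1 • X 1 + t.2.2 • X 2

/-- The cone spanned by `x¹` and `x²`, with the vertex `-c (x¹ + x²)`. -/
def shiftedCone (X : Fin 3 → EuclideanSpace ℝ (Fin 2)) (c : ℝ) : Set (EuclideanSpace ℝ (Fin 2)) :=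
  {v | ∃ j₁ j₂ : ℝ, 0 ≤ j₁ ∧ 0 ≤ j₂ ∧ v = (j₁ - c) • X 0 + (j₂ - c) • X 1}

theorem zero_mem_shiftedCone (X : Fin 3 → EuclideanSpace ℝ (Fin 2)) {c : ℝ} (hc : 0 ≤ c) :
    0 ∈ shiftedCone X c := ⟨c, c, hc, hc, by simp⟩

theorem hexShift_mem_shiftedCone (X : Fin 3 → EuclideanSpace ℝ (Fin 2)) {α : Fin 3 → ℝ}
    {k : ℤ × ℤ} (hk : hexCoeff α k ≠ 0) : hexShift X α k ∈ shiftedCone X (α 2) :=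
  ⟨k.1, k.2, by exact_mod_cast (nonneg_of_hexCoeff_ne_zero hk).1,
    by exact_mod_cast (nonneg_of_hexCoeff_ne_zero hk).2, rfl⟩

theorem measurable_coneDensity (α : Fin 3 → ℝ) : Measurable (coneDensity α) :=
  ((measurable_coneWeight _).comp measurable_fst).mul
    (((measurable_coneWeight _).comp (measurable_fst.comp measurable_snd)).mul
      ((measurable_coneWeight _).comp (measurable_snd.comp measurable_snd)))

theorem continuous_conePoint (X : Fin 3 → EuclideanSpace ℝ (Fin 2)) : Continuous (conePoint X) := by
  unfold conePoint
  fun_prop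

theorem coneDensity_nonneg {α : Fin 3 → ℝ} (hα : ∀ k, 0 < α k) (t : ℝ × ℝ × ℝ) :
    0 ≤ coneDensity α t :=
  mul_nonneg (coneWeight_nonneg (hα 1) _)
    (mul_nonneg (coneWeight_nonneg (hα 0) _) (coneWeight_nonneg (hα 2) _))

theorem pos_of_coneDensity_ne_zero {α : Fin 3 → ℝ} {t : ℝ × ℝ × ℝ} (ht : coneDensity α t ≠ 0) :
    0 < t.1 ∧ 0 < t.2.1 ∧ 0 < t.2.2 := by
  refine ⟨?_, ?_, ?_⟩ <;>
  · by_contra h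
    exact ht (by simp [coneDensity, coneWeight_of_nonpos (not_lt.1 h)])

/-- The cone is pointed: the coefficients of `t₁ x¹ + t₂ x² + t₃ x³ + v` are bounded by its norm,
uniformly for `v` in a translate of the cone. -/
theorem exists_one_add_abs_le {X : Fin 3 → EuclideanSpace ℝ (Fin 2)}
    (hX : IsThreeDirectionalMesh X) {c : ℝ} (hc : 0 ≤ c) :
    ∃ K : ℝ, 0 < K ∧ ∀ v ∈ shiftedCone X c, ∀ t : ℝ × ℝ × ℝ, 0 < t.1 → 0 < t.2.1 → 0 < t.2.2 →
      1 + |t.1| ≤ K * (1 + ‖conePoint X t + v‖) ∧ 1 + |t.2.1| ≤ K * (1 + ‖conePoint X t + v‖) ∧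
        1 + |t.2.2| ≤ K * (1 + ‖conePoint X t + v‖) := by
  obtain ⟨h0, h1⟩ := hX.snd_eq
  have hp := hX.apply_zero_one_ne_zero
  set p₀ := X 0 0
  set p₁ := X 0 1
  refine ⟨1 + (1 + |p₀ / p₁| + |1 / p₁|) + c, by positivity, ?_⟩
  rintro v ⟨j₁, j₂, hj₁, hj₂, rfl⟩ ⟨t₂, t₁, t₃⟩ ht₂ ht₁ ht₃
  simp only at ht₁ ht₂ ht₃
  set y := conePoint X (t₂, t₁, t₃) + ((j₁ - c) • X 0 + (j₂ - c) • X 1) with hy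
  have hy0 : y 0 = (t₁ + t₃ + j₁ - c) * p₀ + (t₂ + t₃ + j₂ - c) * (1 - p₀) := by
    simp [hy, conePoint, hX.third_eq_add, h0]
    ring
  have hy1 : y 1 = (t₁ + t₃ + j₁ - c) * p₁ - (t₂ + t₃ + j₂ - c) * p₁ := by
    simp [hy, conePoint, hX.third_eq_add, h1]
    ring
  -- The coordinates of `y` in the basis `x¹, x²` are linear in `y`. As `j₁, j₂` and the `t_k` are
  -- nonnegative, each `t_k` is at most one of these coordinates plus `c`.
  have hB : t₂ + t₃ + j₂ - c = y 0 - p₀ / p₁ * y 1 := by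
    rw [hy0, hy1]; field_simp; ring
  have hA : t₁ + t₃ + j₁ - c = y 0 - p₀ / p₁ * y 1 + 1 / p₁ * y 1 := by
    rw [hy0, hy1]; field_simp; ring
  have hn0 : |y 0| ≤ ‖y‖ := PiLp.norm_apply_le y 0
  have hn1 : |y 1| ≤ ‖y‖ := PiLp.norm_apply_le y 1
  have e1 : -(p₀ / p₁ * y 1) ≤ |p₀ / p₁| * ‖y‖ := by
    refine (neg_le_abs _).trans ?_
    rw [abs_mul]; gcongr
  have e2 : 1 / p₁ * y 1 ≤ |1 / p₁| * ‖y‖ := by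
    refine (le_abs_self _).trans ?_
    rw [abs_mul]; gcongr
  have e3 := (le_abs_self (y 0)).trans hn0
  have e4 : 0 ≤ |1 / p₁| * ‖y‖ := by positivity
  have e5 : 0 ≤ |p₀ / p₁| * ‖y‖ := by positivity
  have e6 : 0 ≤ c * ‖y‖ := by positivity
  have e7 : 0 ≤ |p₀ / p₁| := abs_nonneg _
  have e8 : 0 ≤ |1 / p₁| := abs_nonneg _
  have e9 := norm_nonneg y
  simp only [abs_of_pos ht₁, abs_of_pos ht₂, abs_of_pos ht₃]
  refine ⟨?_, ?_, ?_⟩ <;> nlinarith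

/-- Uniform domination of the integrands of the cone spline on Schwartz functions. -/
theorem exists_dominating {X : Fin 3 → EuclideanSpace ℝ (Fin 2)} {α : Fin 3 → ℝ}
    (hX : IsThreeDirectionalMesh X) (hα : ∀ k, 0 < α k) :
    ∃ (D : ℝ × ℝ × ℝ → ℝ) (s : Finset (ℕ × ℕ)), Integrable D ∧ (∀ t, 0 ≤ D t) ∧
      ∀ v ∈ shiftedCone X (α 2), ∀ (g : 𝓢(EuclideanSpace ℝ (Fin 2), ℂ)) (t : ℝ × ℝ × ℝ),
        coneDensity α t * ‖g (conePoint X t + v)‖ ≤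
          D t * s.sup (schwartzSeminormFamily ℂ (EuclideanSpace ℝ (Fin 2)) ℂ) g := by
  obtain ⟨K, hK, hbound⟩ := exists_one_add_abs_le hX (hα 2).le
  obtain ⟨m, hm⟩ := exists_nat_gt (max (α 0) (max (α 1) (α 2)))
  have hm0 : α 0 < m := (le_max_left _ _).trans_lt hm
  have hm1 : α 1 < m := ((le_max_left _ _).trans (le_max_right _ _)).trans_lt hm
  have hm2 : α 2 < m := ((le_max_right _ _).trans (le_max_right _ _)).trans_lt hm
  set E : ℝ × ℝ × ℝ → ℝ := fun t => (coneWeight (α 1) t.1 * ((1 + |t.1|) ^ m)⁻¹) *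
    ((coneWeight (α 0) t.2.1 * ((1 + |t.2.1|) ^ m)⁻¹) *
      (coneWeight (α 2) t.2.2 * ((1 + |t.2.2|) ^ m)⁻¹)) with hE
  have hE' : ∀ t, E t = coneDensity α t *
      ((1 + |t.1|) ^ m * (1 + |t.2.1|) ^ m * (1 + |t.2.2|) ^ m)⁻¹ := by
    intro t
    simp only [hE, coneDensity, mul_inv]
    ring
  -- Each of the three factors `(1 + |t_k|)^m` costs `K^m (1 + ‖y‖)^m`, hence a seminorm of decay
  -- order `3m`; `2^(3m)` is the constant in the Schwartz bound for `(1 + ‖y‖)^(3m)`.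
  refine ⟨fun t => K ^ (3 * m) * 2 ^ (3 * m) * E t, Finset.Iic (3 * m, 0), ?_, ?_, ?_⟩
  · refine Integrable.const_mul ?_ _
    exact (integrable_coneWeight_mul_one_add_pow (hα 1) hm1).mul_prod
      ((integrable_coneWeight_mul_one_add_pow (hα 0) hm0).mul_prod
        (integrable_coneWeight_mul_one_add_pow (hα 2) hm2))
  · intro t
    beta_reduce
    rw [hE']
    have := coneDensity_nonneg hα t
    positivity
  · intro v hv g t
    beta_reduce
    rw [hE']
    by_cases h0 : coneDensity α t = 0
    · simp [h0]
    obtain ⟨h1, h2, h3⟩ := pos_of_coneDensity_ne_zero h0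
    obtain ⟨b1, b2, b3⟩ := hbound v hv t h1 h2 h3
    set y := conePoint X t + v
    have hg : (1 + ‖y‖) ^ (3 * m) * ‖g y‖ ≤ 2 ^ (3 * m) *
        (Finset.Iic (3 * m, 0)).sup (schwartzSeminormFamily ℂ (EuclideanSpace ℝ (Fin 2)) ℂ) g := by
      have := SchwartzMap.one_add_le_sup_seminorm_apply (𝕜 := ℂ) (m := (3 * m, 0)) (k := 3 * m)
        (n := 0) le_rfl le_rfl g y
      rwa [norm_iteratedFDeriv_zero] at this
    set S := (Finset.Iic (3 * m, 0)).sup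
      (schwartzSeminormFamily ℂ (EuclideanSpace ℝ (Fin 2)) ℂ) g
    have hP : (1 + |t.1|) ^ m * (1 + |t.2.1|) ^ m * (1 + |t.2.2|) ^ m ≤
        K ^ (3 * m) * (1 + ‖y‖) ^ (3 * m) := by
      calc _ ≤ (K * (1 + ‖y‖)) ^ m * (K * (1 + ‖y‖)) ^ m * (K * (1 + ‖y‖)) ^ m := by gcongr
        _ = _ := by rw [← mul_pow K, pow_mul', pow_succ, pow_two]
    set P := (1 + |t.1|) ^ m * (1 + |t.2.1|) ^ m * (1 + |t.2.2|) ^ m with hPdef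
    have hPpos : 0 < P := by positivity
    have key : ‖g y‖ ≤ K ^ (3 * m) * 2 ^ (3 * m) * P⁻¹ * S := by
      rw [mul_right_comm, ← div_eq_mul_inv, le_div_iff₀ hPpos]
      calc ‖g y‖ * P ≤ ‖g y‖ * (K ^ (3 * m) * (1 + ‖y‖) ^ (3 * m)) := by gcongr
        _ = K ^ (3 * m) * ((1 + ‖y‖) ^ (3 * m) * ‖g y‖) := by ring
        _ ≤ K ^ (3 * m) * (2 ^ (3 * m) * S) := by gcongr
        _ = _ := by ring
    calc coneDensity α t * ‖g y‖ ≤ coneDensity α t * (K ^ (3 * m) * 2 ^ (3 * m) * P⁻¹ * S) :=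
          mul_le_mul_of_nonneg_left key (coneDensity_nonneg hα t)
      _ = _ := by ring

/-! ### The regularized symbol and removal of the damping -/

/-- The damping factor `e^{-(ε₁ t₁ + ε₂ t₂ + ε₃ t₃)}`, where `t = (t₂, (t₁, t₃))`. -/
noncomputable def coneDamping (ε : Fin 3 → ℝ) (t : ℝ × ℝ × ℝ) : ℝ :=
  Real.exp (-(ε 1 * t.1)) * (Real.exp (-(ε 0 * t.2.1)) * Real.exp (-(ε 2 * t.2.2)))

theorem continuous_coneDamping (ε : Fin 3 → ℝ) : Continuous (coneDamping ε) := by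
  unfold coneDamping
  fun_prop

theorem integrable_coneDensity_mul_coneDamping {α ε : Fin 3 → ℝ} (hα : ∀ k, 0 < α k)
    (hε : ∀ k, 0 < ε k) : Integrable fun t => coneDensity α t * coneDamping ε t := by
  refine ((integrable_coneWeight_mul_exp (hα 1) (hε 1)).mul_prod
    ((integrable_coneWeight_mul_exp (hα 0) (hε 0)).mul_prod
        (integrable_coneWeight_mul_exp (hα 2) (hε 2)))).congr (Eventually.of_forall fun t => ?_)
  simp only [coneDensity, coneDamping]
  ring

/-- The integrand is a product over the three variables, with one-dimensional Laplace transforms at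
`ε_k + i⟨ω, x^k⟩` as factors. -/
theorem integral_coneDensity_mul_cexp_inner (X : Fin 3 → EuclideanSpace ℝ (Fin 2))
    {α ε : Fin 3 → ℝ} (hα : ∀ k, 0 < α k) (hε : ∀ k, 0 < ε k) (ω : EuclideanSpace ℝ (Fin 2)) :
    ∫ t, ((coneDensity α t * coneDamping ε t : ℝ) : ℂ) *
      Complex.exp (-Complex.I * (⟪ω, conePoint X t⟫ : ℝ)) = coneSymbol X α ε ω := by
  have hk : ∀ k, ∫ t, (coneWeight (α k) t : ℂ) *
      Complex.exp (-(((ε k : ℂ) + Complex.I * (⟪ω, X k⟫ : ℝ)) * t)) =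
        coneFactor (α k) (ε k) ⟪ω, X k⟫ := fun k =>
    integral_coneWeight_mul_cexp (hα k) (by simpa using hε k)
  set F : Fin 3 → ℝ → ℂ := fun k t => (coneWeight (α k) t : ℂ) *
    Complex.exp (-(((ε k : ℂ) + Complex.I * (⟪ω, X k⟫ : ℝ)) * t)) with hF
  have h : ∀ t : ℝ × ℝ × ℝ, ((coneDensity α t * coneDamping ε t : ℝ) : ℂ) *
      Complex.exp (-Complex.I * (⟪ω, conePoint X t⟫ : ℝ)) =
        F 1 t.1 * (F 0 t.2.1 * F 2 t.2.2) := by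
    intro t
    have he : Complex.exp (-Complex.I * (⟪ω, conePoint X t⟫ : ℝ)) =
        Complex.exp (-Complex.I * (⟪ω, X 1⟫ : ℝ) * t.1) *
          (Complex.exp (-Complex.I * (⟪ω, X 0⟫ : ℝ) * t.2.1) *
            Complex.exp (-Complex.I * (⟪ω, X 2⟫ : ℝ) * t.2.2)) := by
      rw [← Complex.exp_add, ← Complex.exp_add]
      congr 1
      simp only [conePoint, inner_add_right, inner_smul_right]
      push_cast
      ring
    have hFk : ∀ (k : Fin 3) (r : ℝ), F k r = (coneWeight (α k) r : ℂ) *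
        (Complex.exp (-(ε k * r)) * Complex.exp (-Complex.I * (⟪ω, X k⟫ : ℝ) * r)) := by
      intro k r
      rw [← Complex.exp_add, hF]
      ring_nf
    rw [he, hFk, hFk, hFk, coneDensity, coneDamping]
    push_cast
    ring
  simp only [h]
  rw [Measure.volume_eq_prod, integral_prod_mul (F 1) (fun r : ℝ × ℝ => F 0 r.1 * F 2 r.2),
    Measure.volume_eq_prod, integral_prod_mul (F 0) (F 2), hk, hk, hk, coneSymbol,
    Fin.prod_univ_three]
  ring

/-- The regularized symbol, tested against a Schwartz function. -/
theorem integral_coneSymbol_mul (X : Fin 3 → EuclideanSpace ℝ (Fin 2)) {α ε : Fin 3 → ℝ}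
    (hα : ∀ k, 0 < α k) (hε : ∀ k, 0 < ε k) (v : EuclideanSpace ℝ (Fin 2))
    (g : 𝓢(EuclideanSpace ℝ (Fin 2), ℂ)) :
    ∫ ω, Complex.exp (-Complex.I * (⟪ω, v⟫ : ℝ)) * (coneSymbol X α ε ω * g ω) =
      ∫ t, ((coneDensity α t * coneDamping ε t : ℝ) : ℂ) *
        angularFourier 2 g (conePoint X t + v) := by
  -- Fubini is applied while the damping is present; the undamped density is not integrable.
  have hint : Integrable (Function.uncurry fun (ω : EuclideanSpace ℝ (Fin 2)) (t : ℝ × ℝ × ℝ) =>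
      ((coneDensity α t * coneDamping ε t : ℝ) : ℂ) *
        (Complex.exp (-Complex.I * (⟪ω, conePoint X t + v⟫ : ℝ)) * g ω))
      (volume.prod volume) := by
    have h : Integrable (fun z : EuclideanSpace ℝ (Fin 2) × ℝ × ℝ × ℝ =>
        g z.1 * ((coneDensity α z.2 * coneDamping ε z.2 : ℝ) : ℂ)) (volume.prod volume) :=
      (g.integrable (μ := volume)).mul_prod
      ((integrable_coneDensity_mul_coneDamping hα hε).ofReal (𝕜 := ℂ))
    have hcont : Continuous fun z : EuclideanSpace ℝ (Fin 2) × ℝ × ℝ × ℝ =>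
        Complex.exp (-Complex.I * (⟪z.1, conePoint X z.2 + v⟫ : ℝ)) := by
      have := continuous_conePoint X
      fun_prop
    refine (h.bdd_mul (c := 1) hcont.aestronglyMeasurable
      (Eventually.of_forall fun z => (norm_exp_neg_I_mul _).le)).congr
      (Eventually.of_forall fun z => ?_)
    simp only [Function.uncurry]
    push_cast
    ring
  have hsplit : ∀ (ω : EuclideanSpace ℝ (Fin 2)) (y : EuclideanSpace ℝ (Fin 2)),
      Complex.exp (-Complex.I * (⟪ω, y + v⟫ : ℝ)) =
        Complex.exp (-Complex.I * (⟪ω, y⟫ : ℝ)) * Complex.exp (-Complex.I * (⟪ω, v⟫ : ℝ)) := by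
    intro ω y
    rw [← Complex.exp_add, inner_add_right]
    push_cast
    ring_nf
  calc _ = ∫ ω, ∫ t, ((coneDensity α t * coneDamping ε t : ℝ) : ℂ) *
        (Complex.exp (-Complex.I * (⟪ω, conePoint X t + v⟫ : ℝ)) * g ω) := by
        refine integral_congr_ae (Eventually.of_forall fun ω => ?_)
        beta_reduce
        rw [← integral_coneDensity_mul_cexp_inner X hα hε ω, mul_comm (∫ _, _) (g ω), ← mul_assoc,
          ← integral_const_mul]
        refine integral_congr_ae (Eventually.of_forall fun t => ?_)
        beta_reduce
        rw [hsplit]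
        ring
    _ = ∫ t, ∫ ω, ((coneDensity α t * coneDamping ε t : ℝ) : ℂ) *
        (Complex.exp (-Complex.I * (⟪ω, conePoint X t + v⟫ : ℝ)) * g ω) :=
        integral_integral_swap hint
    _ = _ := by
        refine integral_congr_ae (Eventually.of_forall fun t => ?_)
        beta_reduce
        rw [integral_const_mul, angularFourier_apply]

theorem coneDamping_pos (ε : Fin 3 → ℝ) (t : ℝ × ℝ × ℝ) : 0 < coneDamping ε t := by
  unfold coneDamping
  positivity

theorem coneDensity_mul_coneDamping_le {α ε : Fin 3 → ℝ} (hα : ∀ k, 0 < α k)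
    (hε : ∀ k, 0 < ε k) (t : ℝ × ℝ × ℝ) :
    coneDensity α t * coneDamping ε t ≤ coneDensity α t := by
  by_cases h0 : coneDensity α t = 0
  · simp [h0]
  obtain ⟨h1, h2, h3⟩ := pos_of_coneDensity_ne_zero h0
  refine mul_le_of_le_one_right (coneDensity_nonneg hα t) ?_
  rw [coneDamping, ← Real.exp_add, ← Real.exp_add]
  refine Real.exp_le_one_iff.2 ?_
  have := mul_pos (hε 1) h1
  have := mul_pos (hε 0) h2
  have := mul_pos (hε 2) h3
  linarith

theorem aestronglyMeasurable_coneDensity_mul (X : Fin 3 → EuclideanSpace ℝ (Fin 2))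
    (α : Fin 3 → ℝ) (v : EuclideanSpace ℝ (Fin 2)) (g : 𝓢(EuclideanSpace ℝ (Fin 2), ℂ)) :
    AEStronglyMeasurable fun t => (coneDensity α t : ℂ) * g (conePoint X t + v) := by
  refine (Complex.measurable_ofReal.comp (measurable_coneDensity α)).aestronglyMeasurable.mul ?_
  exact (g.continuous.comp ((continuous_conePoint X).add continuous_const)).aestronglyMeasurable

theorem integrable_coneDensity_mul {X : Fin 3 → EuclideanSpace ℝ (Fin 2)} {α : Fin 3 → ℝ}
    (hX : IsThreeDirectionalMesh X) (hα : ∀ k, 0 < α k) {v : EuclideanSpace ℝ (Fin 2)}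
    (hv : v ∈ shiftedCone X (α 2)) (g : 𝓢(EuclideanSpace ℝ (Fin 2), ℂ)) :
    Integrable fun t => (coneDensity α t : ℂ) * g (conePoint X t + v) := by
  obtain ⟨D, s, hD, -, hle⟩ := exists_dominating hX hα
  refine (hD.mul_const (s.sup (schwartzSeminormFamily ℂ (EuclideanSpace ℝ (Fin 2)) ℂ) g)).mono'
    (aestronglyMeasurable_coneDensity_mul X α v g)
    (Eventually.of_forall fun t => ?_)
  rw [norm_mul, Complex.norm_real, Real.norm_of_nonneg (coneDensity_nonneg hα t)]
  exact hle v hv g t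

/-- On the octant carrying the density the damping is at most `1`, whatever the ratios of the `ε_k`,
so the undamped integrand dominates and the parameters may tend to `0` independently. -/
theorem tendsto_integral_coneDamping {X : Fin 3 → EuclideanSpace ℝ (Fin 2)} {α : Fin 3 → ℝ}
    (hX : IsThreeDirectionalMesh X) (hα : ∀ k, 0 < α k) {v : EuclideanSpace ℝ (Fin 2)}
    (hv : v ∈ shiftedCone X (α 2)) (g : 𝓢(EuclideanSpace ℝ (Fin 2), ℂ)) :
    Tendsto (fun ε : Fin 3 → ℝ => ∫ t, ((coneDensity α t * coneDamping ε t : ℝ) : ℂ) *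
        g (conePoint X t + v)) (𝓝[{ε | ∀ k, 0 < ε k}] 0)
      (𝓝 (∫ t, (coneDensity α t : ℂ) * g (conePoint X t + v))) := by
  refine tendsto_integral_filter_of_dominated_convergence _ ?_ ?_
    (integrable_coneDensity_mul hX hα hv g).norm ?_
  · refine Eventually.of_forall fun ε => ?_
    refine ((aestronglyMeasurable_coneDensity_mul X α v g).mul
      (Complex.continuous_ofReal.comp (continuous_coneDamping ε)).aestronglyMeasurable).congr
      (Eventually.of_forall fun t => ?_)
    simp only [Pi.mul_apply, Function.comp_apply]
    push_cast
    ring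
  · filter_upwards [self_mem_nhdsWithin] with ε hε
    refine Eventually.of_forall fun t => ?_
    rw [norm_mul, norm_mul, Complex.norm_real, Complex.norm_real,
      Real.norm_of_nonneg (coneDensity_nonneg hα t),
      Real.norm_of_nonneg (mul_nonneg (coneDensity_nonneg hα t) (coneDamping_pos ε t).le)]
    exact mul_le_mul_of_nonneg_right (coneDensity_mul_coneDamping_le hα hε t) (norm_nonneg _)
  · refine Eventually.of_forall fun t => ?_
    have hcont : Continuous fun ε : Fin 3 → ℝ =>
        ((coneDensity α t * coneDamping ε t : ℝ) : ℂ) * g (conePoint X t + v) := by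
      unfold coneDamping
      fun_prop
    have := (hcont.tendsto 0).mono_left (nhdsWithin_le_nhds (s := {ε | ∀ k, 0 < ε k}))
    simpa [coneDamping] using this

theorem angularFourier_surjective (s : ℕ) : Function.Surjective (angularFourier s) := by
  intro h
  set e : EuclideanSpace ℝ (Fin s) ≃L[ℝ] EuclideanSpace ℝ (Fin s) :=
    ContinuousLinearEquiv.smulLeft
      (Units.mk0 ((2 * Real.pi)⁻¹ : ℝ) (inv_ne_zero Real.two_pi_pos.ne')) with he
  refine ⟨FourierTransform.fourierInv (SchwartzMap.compCLMOfContinuousLinearEquiv ℂ e.symm h), ?_⟩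
  ext x
  simp only [angularFourier, ContinuousLinearMap.comp_apply, FourierTransform.fourierCLM_apply,
    FourierTransform.fourier_fourierInv_eq, ← he]
  simp

/-- The limits determine the distribution on all transforms of Schwartz functions, which exhaust the
Schwartz space. They are unique because `0` is a limit point of the open positive orthant. -/
theorem HasFourierBoundaryValue.unique {n s : ℕ} {u v : 𝓢'(EuclideanSpace ℝ (Fin s), ℂ)}
    {S : (Fin n → ℝ) → EuclideanSpace ℝ (Fin s) → ℂ} (hu : HasFourierBoundaryValue u S)
    (hv : HasFourierBoundaryValue v S) : u = v := by
  have : (𝓝[{ε : Fin n → ℝ | ∀ k, 0 < ε k}] 0).NeBot := by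
    have hset : {ε : Fin n → ℝ | ∀ k, 0 < ε k} = Set.univ.pi fun _ => Set.Ioi 0 := by
      ext; simp
    rw [hset, ← mem_closure_iff_nhdsWithin_neBot, closure_pi_set]
    simp [Pi.le_def]
  ext g
  obtain ⟨f, rfl⟩ := angularFourier_surjective s g
  exact tendsto_nhds_unique (hu f) (hv f)

/-! ### Construction of the splines and the identity of distributions -/

/-- The integral of a translate of `g` against the cone spline. -/
noncomputable def coneIntegral (X : Fin 3 → EuclideanSpace ℝ (Fin 2)) (α : Fin 3 → ℝ)
    (v : EuclideanSpace ℝ (Fin 2)) (g : 𝓢(EuclideanSpace ℝ (Fin 2), ℂ)) : ℂ :=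
  ∫ t, (coneDensity α t : ℂ) * g (conePoint X t + v)

section

variable {X : Fin 3 → EuclideanSpace ℝ (Fin 2)} {α : Fin 3 → ℝ}

/-- One bound, with the same seminorm for all shifts, serves both the continuity of the splines and
the summability over the lattice. -/
theorem exists_integral_norm_le (hX : IsThreeDirectionalMesh X) (hα : ∀ k, 0 < α k) :
    ∃ (s : Finset (ℕ × ℕ)) (K : ℝ), 0 ≤ K ∧ ∀ v ∈ shiftedCone X (α 2),
      ∀ g : 𝓢(EuclideanSpace ℝ (Fin 2), ℂ),
        ∫ t, coneDensity α t * ‖g (conePoint X t + v)‖ ≤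
          K * s.sup (schwartzSeminormFamily ℂ (EuclideanSpace ℝ (Fin 2)) ℂ) g := by
  obtain ⟨D, s, hD, hD0, hle⟩ := exists_dominating hX hα
  refine ⟨s, ∫ t, D t, integral_nonneg hD0, fun v hv g => ?_⟩
  rw [← integral_mul_const]
  refine integral_mono_of_nonneg (Eventually.of_forall fun t => ?_) (hD.mul_const _)
    (Eventually.of_forall fun t => hle v hv g t)
  exact mul_nonneg (coneDensity_nonneg hα t) (norm_nonneg _)

theorem integrable_coneDensity_mul_norm (hX : IsThreeDirectionalMesh X) (hα : ∀ k, 0 < α k)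
    {v : EuclideanSpace ℝ (Fin 2)} (hv : v ∈ shiftedCone X (α 2))
    (g : 𝓢(EuclideanSpace ℝ (Fin 2), ℂ)) :
    Integrable fun t => coneDensity α t * ‖g (conePoint X t + v)‖ := by
  refine (integrable_coneDensity_mul hX hα hv g).norm.congr (Eventually.of_forall fun t => ?_)
  simp [abs_of_nonneg (coneDensity_nonneg hα t)]

theorem norm_coneIntegral_le (hα : ∀ k, 0 < α k)
    (v : EuclideanSpace ℝ (Fin 2)) (g : 𝓢(EuclideanSpace ℝ (Fin 2), ℂ)) :
    ‖coneIntegral X α v g‖ ≤ ∫ t, coneDensity α t * ‖g (conePoint X t + v)‖ := by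
  refine (norm_integral_le_integral_norm _).trans_eq
    (integral_congr_ae (Eventually.of_forall fun t => ?_))
  simp [abs_of_nonneg (coneDensity_nonneg hα t)]

theorem norm_integral_coneDamping_le (hX : IsThreeDirectionalMesh X) (hα : ∀ k, 0 < α k)
    {ε : Fin 3 → ℝ} (hε : ∀ k, 0 < ε k)
    {v : EuclideanSpace ℝ (Fin 2)} (hv : v ∈ shiftedCone X (α 2))
    (g : 𝓢(EuclideanSpace ℝ (Fin 2), ℂ)) :
    ‖∫ t, ((coneDensity α t * coneDamping ε t : ℝ) : ℂ) * g (conePoint X t + v)‖ ≤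
      ∫ t, coneDensity α t * ‖g (conePoint X t + v)‖ := by
  refine norm_integral_le_of_norm_le (integrable_coneDensity_mul_norm hX hα hv g)
    (Eventually.of_forall fun t => ?_)
  rw [norm_mul, Complex.norm_real,
    Real.norm_of_nonneg (mul_nonneg (coneDensity_nonneg hα t) (coneDamping_pos ε t).le)]
  exact mul_le_mul_of_nonneg_right (coneDensity_mul_coneDamping_le hα hε t) (norm_nonneg _)

theorem coneIntegral_add (hX : IsThreeDirectionalMesh X) (hα : ∀ k, 0 < α k)
    {v : EuclideanSpace ℝ (Fin 2)} (hv : v ∈ shiftedCone X (α 2))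
    (f g : 𝓢(EuclideanSpace ℝ (Fin 2), ℂ)) :
    coneIntegral X α v (f + g) = coneIntegral X α v f + coneIntegral X α v g := by
  rw [coneIntegral, coneIntegral, coneIntegral, ← integral_add
    (integrable_coneDensity_mul hX hα hv f) (integrable_coneDensity_mul hX hα hv g)]
  simp only [add_apply, mul_add]

theorem coneIntegral_smul (v : EuclideanSpace ℝ (Fin 2)) (a : ℂ)
    (g : 𝓢(EuclideanSpace ℝ (Fin 2), ℂ)) :
    coneIntegral X α v (a • g) = a * coneIntegral X α v g := by
  rw [coneIntegral, coneIntegral, ← integral_const_mul]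
  simp only [smul_apply, smul_eq_mul, mul_left_comm]

theorem exists_coneSpline (hX : IsThreeDirectionalMesh X) (hα : ∀ k, 0 < α k) :
    ∃ C : 𝓢'(EuclideanSpace ℝ (Fin 2), ℂ), ∀ g, C g = coneIntegral X α 0 g := by
  have h0 := zero_mem_shiftedCone X (hα 2).le
  obtain ⟨s, K, hK, hle⟩ := exists_integral_norm_le hX hα
  exact ⟨ContinuousLinearMap.toPointwiseConvergenceCLM _ _ _ _
    (SchwartzMap.mkCLMtoNormedSpace (σ := RingHom.id ℂ) (coneIntegral X α 0)
      (coneIntegral_add hX hα h0) (coneIntegral_smul 0)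
      ⟨s, K, hK, fun g => (norm_coneIntegral_le hα 0 g).trans (hle 0 h0 g)⟩), fun g => rfl⟩

theorem isFractionalConeSpline_of_eq (hX : IsThreeDirectionalMesh X) (hα : ∀ k, 0 < α k)
    {C : 𝓢'(EuclideanSpace ℝ (Fin 2), ℂ)} (hC : ∀ g, C g = coneIntegral X α 0 g) :
    IsFractionalConeSpline X α C := by
  intro g
  rw [distFourier_apply, hC]
  refine (tendsto_integral_coneDamping hX hα (zero_mem_shiftedCone X (hα 2).le)
    (angularFourier 2 g)).congr' ?_
  filter_upwards [self_mem_nhdsWithin] with ε hε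
  rw [← integral_coneSymbol_mul X hα hε 0 g]
  simp

theorem distTranslate_coneSpline
    {C : 𝓢'(EuclideanSpace ℝ (Fin 2), ℂ)} (hC : ∀ g, C g = coneIntegral X α 0 g)
    (v : EuclideanSpace ℝ (Fin 2)) (g : 𝓢(EuclideanSpace ℝ (Fin 2), ℂ)) :
    distTranslate v C g = coneIntegral X α v g := by
  rw [distTranslate_apply, hC, coneIntegral, coneIntegral]
  simp

theorem summable_hexCoeff_mul_integral_norm (hX : IsThreeDirectionalMesh X) (hα : ∀ k, 0 < α k)
    (g : 𝓢(EuclideanSpace ℝ (Fin 2), ℂ)) :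
    Summable fun k => |hexCoeff α k| *
      ∫ t, coneDensity α t * ‖g (conePoint X t + hexShift X α k)‖ := by
  obtain ⟨s, K, hK, hle⟩ := exists_integral_norm_le hX hα
  refine Summable.of_nonneg_of_le (fun k => ?_) (fun k => ?_) ((summable_abs_hexCoeff hα).mul_right
    (K * s.sup (schwartzSeminormFamily ℂ (EuclideanSpace ℝ (Fin 2)) ℂ) g))
  · exact mul_nonneg (abs_nonneg _) (integral_nonneg fun t =>
      mul_nonneg (coneDensity_nonneg hα t) (norm_nonneg _))
  -- Shifts with zero coefficient may leave the translated cone, where the integral has no bound;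
  -- they are discarded first.
  · by_cases h : hexCoeff α k = 0
    · simp [h]
    · exact mul_le_mul_of_nonneg_left (hle _ (hexShift_mem_shiftedCone X h) g) (abs_nonneg _)

theorem summable_norm_hexCoeff_mul_coneIntegral (hX : IsThreeDirectionalMesh X)
    (hα : ∀ k, 0 < α k) (g : 𝓢(EuclideanSpace ℝ (Fin 2), ℂ)) :
    Summable fun k => ‖(hexCoeff α k : ℂ) * coneIntegral X α (hexShift X α k) g‖ := by
  refine Summable.of_nonneg_of_le (fun k => norm_nonneg _) (fun k => ?_)
    (summable_hexCoeff_mul_integral_norm hX hα g)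
  rw [norm_mul, Complex.norm_real, Real.norm_eq_abs]
  exact mul_le_mul_of_nonneg_left (norm_coneIntegral_le hα _ g) (abs_nonneg _)

theorem hexCoeff_mul_coneIntegral_add (hX : IsThreeDirectionalMesh X) (hα : ∀ k, 0 < α k)
    (k : ℤ × ℤ) (f g : 𝓢(EuclideanSpace ℝ (Fin 2), ℂ)) :
    (hexCoeff α k : ℂ) * coneIntegral X α (hexShift X α k) (f + g) =
      hexCoeff α k * coneIntegral X α (hexShift X α k) f +
        hexCoeff α k * coneIntegral X α (hexShift X α k) g := by
  by_cases h : hexCoeff α k = 0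
  · simp [h]
  · rw [coneIntegral_add hX hα (hexShift_mem_shiftedCone X h), mul_add]

theorem exists_hexSpline (hX : IsThreeDirectionalMesh X) (hα : ∀ k, 0 < α k) :
    ∃ B : 𝓢'(EuclideanSpace ℝ (Fin 2), ℂ), ∀ g,
      B g = ∑' k, (hexCoeff α k : ℂ) * coneIntegral X α (hexShift X α k) g := by
  obtain ⟨s, K, hK, hle⟩ := exists_integral_norm_le hX hα
  have hsum := fun g => summable_norm_hexCoeff_mul_coneIntegral hX hα g
  refine ⟨ContinuousLinearMap.toPointwiseConvergenceCLM _ _ _ _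
    (SchwartzMap.mkCLMtoNormedSpace (σ := RingHom.id ℂ)
      (fun g => ∑' k, (hexCoeff α k : ℂ) * coneIntegral X α (hexShift X α k) g)
      (fun f g => ?_) (fun a g => ?_) ⟨s, (∑' k, |hexCoeff α k|) * K,
        mul_nonneg (tsum_nonneg fun _ => abs_nonneg _) hK, fun g => ?_⟩), fun g => rfl⟩
  · simp only [hexCoeff_mul_coneIntegral_add hX hα]
    exact (hsum f).of_norm.tsum_add (hsum g).of_norm
  · simp only [coneIntegral_smul, RingHom.id_apply, smul_eq_mul, mul_left_comm _ a]
    exact tsum_mul_left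
  · refine (norm_tsum_le_tsum_norm (hsum g)).trans ?_
    rw [mul_assoc, ← tsum_mul_right]
    refine (hsum g).tsum_le_tsum (fun k => ?_) ((summable_abs_hexCoeff hα).mul_right _)
    rw [norm_mul, Complex.norm_real, Real.norm_eq_abs]
    by_cases h : hexCoeff α k = 0
    · simp [h]
    · exact mul_le_mul_of_nonneg_left ((norm_coneIntegral_le hα _ g).trans
        (hle _ (hexShift_mem_shiftedCone X h) g)) (abs_nonneg _)

theorem norm_coneFactor_le {a ε : ℝ} (ha : 0 < a) (hε : 0 < ε) (ξ : ℝ) :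
    ‖coneFactor a ε ξ‖ ≤ ε ^ (-a) := by
  have hne : (ε : ℂ) + Complex.I * ξ ≠ 0 := fun h => by
    have := congrArg Complex.re h
    simp at this
    exact hε.ne' this
  rw [coneFactor, ← Complex.ofReal_neg, Complex.norm_cpow_real]
  refine Real.rpow_le_rpow_of_nonpos hε ?_ (by linarith)
  simpa [abs_of_pos hε] using Complex.abs_re_le_norm ((ε : ℂ) + Complex.I * ξ)

theorem continuous_coneSymbol {n s : ℕ} (X : Fin n → EuclideanSpace ℝ (Fin s)) (α : Fin n → ℝ)
    {ε : Fin n → ℝ} (hε : ∀ k, 0 < ε k) : Continuous (coneSymbol X α ε) := by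
  refine continuous_finsetProd _ fun k _ => ?_
  refine Continuous.cpow (by fun_prop) continuous_const fun ω => Or.inl ?_
  simpa using hε k

theorem integrable_coneSymbol_mul {n s : ℕ} (X : Fin n → EuclideanSpace ℝ (Fin s))
    {α ε : Fin n → ℝ} (hα : ∀ k, 0 < α k) (hε : ∀ k, 0 < ε k)
    (g : 𝓢(EuclideanSpace ℝ (Fin s), ℂ)) : Integrable fun ω => coneSymbol X α ε ω * g ω := by
  refine g.integrable.bdd_mul (c := ∏ k, ε k ^ (-α k))
    (continuous_coneSymbol X α hε).aestronglyMeasurable (Eventually.of_forall fun ω => ?_)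
  rw [coneSymbol, norm_prod]
  exact Finset.prod_le_prod (fun _ _ => norm_nonneg _)
    fun k _ => norm_coneFactor_le (hα k) (hε k) _

/-- For fixed positive `ε` the symbol is bounded, so the absolutely convergent expansion of the
multiplier may be integrated term by term. -/
theorem integral_hexMultiplier_mul (hX : IsThreeDirectionalMesh X) {ε : Fin 3 → ℝ}
    (hα : ∀ k, 0 < α k) (hε : ∀ k, 0 < ε k) (g : 𝓢(EuclideanSpace ℝ (Fin 2), ℂ)) :
    ∫ ω, hexMultiplier X α ω * coneSymbol X α ε ω * g ω =
      ∑' k, (hexCoeff α k : ℂ) * ∫ t, ((coneDensity α t * coneDamping ε t : ℝ) : ℂ) *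
        angularFourier 2 g (conePoint X t + hexShift X α k) := by
  have hint := integrable_coneSymbol_mul X hα hε g
  have hF : ∀ k, Integrable fun ω => (hexCoeff α k : ℂ) *
      (Complex.exp (-Complex.I * (⟪ω, hexShift X α k⟫ : ℝ)) * (coneSymbol X α ε ω * g ω)) := by
    intro k
    refine (hint.bdd_mul (c := 1) (Continuous.aestronglyMeasurable (by fun_prop))
      (Eventually.of_forall fun ω => (norm_exp_neg_I_mul _).le)).const_mul _
  have hsum : Summable fun k => ∫ ω, ‖(hexCoeff α k : ℂ) *
      (Complex.exp (-Complex.I * (⟪ω, hexShift X α k⟫ : ℝ)) * (coneSymbol X α ε ω * g ω))‖ := by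
    have : ∀ k, ∫ ω, ‖(hexCoeff α k : ℂ) *
      (Complex.exp (-Complex.I * (⟪ω, hexShift X α k⟫ : ℝ)) * (coneSymbol X α ε ω * g ω))‖ =
        |hexCoeff α k| * ∫ ω, ‖coneSymbol X α ε ω * g ω‖ := by
      intro k
      rw [← integral_const_mul]
      refine integral_congr_ae (Eventually.of_forall fun ω => ?_)
      beta_reduce
      rw [norm_mul, norm_mul, norm_exp_neg_I_mul, one_mul, Complex.norm_real, Real.norm_eq_abs]
    simp only [this]
    exact (summable_abs_hexCoeff hα).mul_right _
  calc _ = ∫ ω, ∑' k, (hexCoeff α k : ℂ) *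
      (Complex.exp (-Complex.I * (⟪ω, hexShift X α k⟫ : ℝ)) * (coneSymbol X α ε ω * g ω)) := by
        refine integral_congr_ae (Eventually.of_forall fun ω => ?_)
        beta_reduce
        rw [mul_assoc, ← (hasSum_hexMultiplier hX.third_eq_add hα ω).tsum_eq, ← tsum_mul_right]
        simp only [mul_assoc]
    _ = ∑' k, ∫ ω, (hexCoeff α k : ℂ) *
      (Complex.exp (-Complex.I * (⟪ω, hexShift X α k⟫ : ℝ)) * (coneSymbol X α ε ω * g ω)) :=
        (hasSum_integral_of_summable_integral_norm hF hsum).tsum_eq.symm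
    _ = _ := by
        refine tsum_congr fun k => ?_
        rw [integral_const_mul, integral_coneSymbol_mul X hα hε]

/-- Dominated convergence for series: the terms converge one by one, and the undamped integrals of
norms majorize them independently of `ε`. -/
theorem isFractionalHexSpline_of_eq (hX : IsThreeDirectionalMesh X) (hα : ∀ k, 0 < α k)
    {B : 𝓢'(EuclideanSpace ℝ (Fin 2), ℂ)}
    (hB : ∀ g, B g = ∑' k, (hexCoeff α k : ℂ) * coneIntegral X α (hexShift X α k) g) :
    IsFractionalHexSpline X α B := by
  intro g
  rw [distFourier_apply, hB]
  have hT : Tendsto (fun ε => ∑' k, (hexCoeff α k : ℂ) *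
      ∫ t, ((coneDensity α t * coneDamping ε t : ℝ) : ℂ) *
        angularFourier 2 g (conePoint X t + hexShift X α k)) (𝓝[{ε | ∀ k, 0 < ε k}] 0)
      (𝓝 (∑' k, (hexCoeff α k : ℂ) *
        coneIntegral X α (hexShift X α k) (angularFourier 2 g))) := by
    refine tendsto_tsum_of_dominated_convergence
      (summable_hexCoeff_mul_integral_norm hX hα (angularFourier 2 g)) (fun k => ?_) ?_
    · by_cases h : hexCoeff α k = 0
      · simpa [h] using tendsto_const_nhds
      · exact (tendsto_integral_coneDamping hX hα (hexShift_mem_shiftedCone X h) _).const_mul _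
    · filter_upwards [self_mem_nhdsWithin] with ε hε k
      rw [norm_mul, Complex.norm_real, Real.norm_eq_abs]
      by_cases h : hexCoeff α k = 0
      · simp [h]
      · exact mul_le_mul_of_nonneg_left (norm_integral_coneDamping_le hX hα hε
          (hexShift_mem_shiftedCone X h) _) (abs_nonneg _)
  refine hT.congr' ?_
  filter_upwards [self_mem_nhdsWithin] with ε hε
  rw [integral_hexMultiplier_mul hX hα hε]

theorem hasSum_hexSpline (hX : IsThreeDirectionalMesh X) (hα : ∀ k, 0 < α k)
    {C B : 𝓢'(EuclideanSpace ℝ (Fin 2), ℂ)} (hC : ∀ g, C g = coneIntegral X α 0 g)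
    (hB : ∀ g, B g = ∑' k, (hexCoeff α k : ℂ) * coneIntegral X α (hexShift X α k) g) :
    HasSum (fun k : ℤ × ℤ => (hexCoeff α k : ℂ) • distTranslate (hexShift X α k) C) B := by
  refine PointwiseConvergenceCLM.tendsto_iff_forall_tendsto.2 fun g => ?_
  have h := (summable_norm_hexCoeff_mul_coneIntegral hX hα g).of_norm.hasSum
  rw [← hB] at h
  refine Tendsto.congr (fun s => ?_) h
  simp [← distTranslate_coneSpline hC]

end

/-! ### The closed form of the cone spline -/

/-- The cone spline in the coordinates `(s, u)` of the point `s x¹ + u x³`, as an integral over the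
fibre of `t ↦ t₁ x¹ + t₂ x² + t₃ x³`. -/
noncomputable def fibreIntegral (a b c s u : ℝ) : ℝ :=
  ∫ τ, coneWeight b τ * (coneWeight a (s + τ) * coneWeight c (u - τ))

/-- This is the exchange of `x¹` and `x²`: `s x¹ + u x³ = -s x² + (u + s) x³`. -/
theorem fibreIntegral_swap (a b c s u : ℝ) :
    fibreIntegral b a c (-s) (u + s) = fibreIntegral a b c s u := by
  rw [fibreIntegral, fibreIntegral, ← integral_add_right_eq_self _ s]
  refine integral_congr_ae (Eventually.of_forall fun τ => ?_)
  beta_reduce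
  rw [show -s + (τ + s) = τ by ring, show u + s - (τ + s) = u - τ by ring, add_comm τ s]
  ring

/-- For `s > 0` the fibre is cut down to `0 < τ < u`, and `τ = u t` yields Euler's integral with `z
= -u/s`. -/
theorem fibreIntegral_of_pos {a b c s : ℝ} (hb : 0 < b) (hc : 0 < c) (hs : 0 < s)
    (u : ℝ) : fibreIntegral a b c s u =
      1 / (Real.Gamma a * Real.Gamma (b + c)) * s ^ (a - 1) * truncPow u (b + c - 1) *
        hyp2F1 (1 - a) b (b + c) (-(u / s)) := by
  rcases le_or_gt u 0 with hu | hu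
  · rw [truncPow, if_neg hu.not_gt, mul_zero, zero_mul, fibreIntegral]
    refine integral_eq_zero_of_ae (Eventually.of_forall fun τ => ?_)
    rcases le_or_gt τ 0 with hτ | hτ
    · simp [coneWeight_of_nonpos hτ]
    · simp [coneWeight_of_nonpos (show u - τ ≤ 0 by linarith)]
  have hΓ := (Real.Gamma_pos_of_pos (add_pos hb hc)).ne'
  have h1 : fibreIntegral a b c s u = ∫ τ in (0 : ℝ)..u,
      coneWeight b τ * (coneWeight a (s + τ) * coneWeight c (u - τ)) := by
    rw [fibreIntegral, intervalIntegral.integral_of_le hu.le, setIntegral_eq_integral_of_forall_compl_eq_zero]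
    intro τ hτ
    rcases le_or_gt τ 0 with h | h
    · simp [coneWeight_of_nonpos h]
    · have : u - τ ≤ 0 := by
        by_contra h'
        exact hτ ⟨h, by linarith⟩
      simp [coneWeight_of_nonpos this]
  have h2 := intervalIntegral.smul_integral_comp_mul_left (a := 0) (b := 1)
    (fun τ => coneWeight b τ * (coneWeight a (s + τ) * coneWeight c (u - τ))) u
  rw [mul_zero, mul_one, ← h1] at h2
  rw [← h2, hyp2F1, truncPow, if_pos hu, add_sub_cancel_left, smul_eq_mul, ← mul_assoc,
    ← intervalIntegral.integral_const_mul, ← intervalIntegral.integral_const_mul,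
    intervalIntegral.integral_of_le zero_le_one, intervalIntegral.integral_of_le zero_le_one,
    integral_Ioc_eq_integral_Ioo, integral_Ioc_eq_integral_Ioo]
  refine setIntegral_congr_fun measurableSet_Ioo fun t ht => ?_
  have ht1 : 0 < 1 - t := by linarith [ht.2]
  have hq : 0 < 1 + u / s * t := by have := ht.1; positivity
  rw [coneWeight_of_pos (mul_pos hu ht.1),
    coneWeight_of_pos (show 0 < s + u * t by have := mul_pos hu ht.1; linarith),
    coneWeight_of_pos (show 0 < u - u * t by nlinarith [ht.2]),
    show s + u * t = s * (1 + u / s * t) by field_simp, show u - u * t = u * (1 - t) by ring,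
    Real.mul_rpow hu.le ht.1.le, Real.mul_rpow hs.le hq.le, Real.mul_rpow hu.le ht1.le,
    show 1 - -(u / s) * t = 1 + u / s * t by ring, show -(1 - a) = a - 1 by ring,
    show b + c - 1 = (b - 1) + (c - 1) + 1 by ring, Real.rpow_add hu, Real.rpow_add hu,
    Real.rpow_one]
  field_simp

theorem coneFormula_eq {p x : EuclideanSpace ℝ (Fin 2)} {a b c : ℝ} (ha : 0 < a) (hb : 0 < b)
    (hc : 0 < c) (hp : 0 < p 1) (hx : x 1 ≠ 0) :
    coneFormula p a b c x =
      1 / p 1 * fibreIntegral a b c (x 1 / p 1) (x 0 - p 0 / p 1 * x 1) := by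
  rw [coneFormula]
  congr 1
  rcases lt_or_gt_of_ne hx with h | h
  · rw [if_neg h.not_gt, if_pos h, ← fibreIntegral_swap,
      fibreIntegral_of_pos ha hc (neg_pos.2 (div_neg_of_neg_of_pos h hp)),
      show x 0 - p 0 / p 1 * x 1 + x 1 / p 1 = x 0 - (p 0 - 1) / p 1 * x 1 by ring,
      div_neg, neg_neg]
  · rw [if_pos h, fibreIntegral_of_pos hb hc (div_pos h hp)]

/-- The exchange symmetry merges the two signs of `x¹₂`; only the absolute value in the prefactor
remembers them. -/
theorem coneFunction_eq {X : Fin 3 → EuclideanSpace ℝ (Fin 2)} {α : Fin 3 → ℝ}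
    (hX : IsThreeDirectionalMesh X) (hα : ∀ k, 0 < α k) {x : EuclideanSpace ℝ (Fin 2)}
    (hx : x 1 ≠ 0) : coneFunction X α x = |X 0 1|⁻¹ *
      fibreIntegral (α 0) (α 1) (α 2) (x 1 / X 0 1) (x 0 - X 0 0 / X 0 1 * x 1) := by
  obtain ⟨h0, h1⟩ := hX.snd_eq
  have hp := hX.apply_zero_one_ne_zero
  rw [coneFunction]
  split_ifs with h
  · rw [coneFormula_eq (hα 0) (hα 1) (hα 2) h hx, abs_of_pos h, one_div]
  · have hneg : X 0 1 < 0 := lt_of_le_of_ne (not_lt.1 h) hp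
    rw [coneFormula_eq (hα 1) (hα 0) (hα 2) (by rw [h1]; linarith) hx, abs_of_neg hneg, one_div,
      ← fibreIntegral_swap (α 0), h0, h1]
    congr 2
    · rw [div_neg]
    · field_simp
      ring

/-- The coordinates `(τ, (s, u))` with `t = (τ, (s + τ, u - τ))` preserve the volume. -/
theorem measurePreserving_fibreCoordinates :
    MeasurePreserving (fun z : ℝ × ℝ × ℝ => (z.1, (z.2.1 + z.1, z.2.2 - z.1))) volume volume := by
  refine (MeasurePreserving.id volume).skew_product
    (g := fun τ (r : ℝ × ℝ) => (r.1 + τ, r.2 - τ)) (by fun_prop) (Eventually.of_forall fun τ => ?_)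
  exact ((measurePreserving_add_right volume τ).prod (measurePreserving_sub_right volume τ)).map_eq

/-- The plane in the coordinates `(s, u)` with `s = x₂ / p₂`, `u = x₁ - (p₁ / p₂) x₂`. -/
theorem measurePreserving_planeCoordinates (p₀ : ℝ) {p₁ : ℝ} (hp : p₁ ≠ 0) :
    MeasurePreserving (fun x : EuclideanSpace ℝ (Fin 2) => (x 1 / p₁, x 0 - p₀ / p₁ * x 1))
      volume (ENNReal.ofReal |p₁| • volume) := by
  have e1 := (volume_preserving_finTwoArrow ℝ).comp
    (EuclideanSpace.volume_preserving_symm_measurableEquiv_toLp (Fin 2))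
  have e2 : MeasurePreserving (Prod.swap : ℝ × ℝ → ℝ × ℝ) volume volume :=
    Measure.measurePreserving_swap
  have e3 : MeasurePreserving (fun r : ℝ × ℝ => (p₁⁻¹ * r.1, r.2 - p₀ / p₁ * r.1))
      ((volume : Measure ℝ).prod volume) ((ENNReal.ofReal |p₁| • volume).prod volume) := by
    refine MeasurePreserving.skew_product (f := fun s : ℝ => p₁⁻¹ * s)
      (g := fun s u => u - p₀ / p₁ * s) ⟨by fun_prop, ?_⟩ (by fun_prop)
      (Eventually.of_forall fun s => (measurePreserving_sub_right volume _).map_eq)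
    rw [Real.map_volume_mul_left (inv_ne_zero hp), inv_inv]
  rw [Measure.prod_smul_left] at e3
  have h := (e3.comp e2).comp e1
  refine Eq.mp (congrArg (fun f => MeasurePreserving f _ _) (funext fun x => ?_)) h
  simp [MeasurableEquiv.finTwoArrow, div_eq_inv_mul]

theorem MeasureTheory.MeasurePreserving.integral_comp_of_integrable {β γ V : Type*}
    [MeasurableSpace β] [MeasurableSpace γ] [NormedAddCommGroup V] [NormedSpace ℝ V]
    {μ : Measure β} {ν : Measure γ} {f : β → γ} (hf : MeasurePreserving f μ ν) {g : γ → V}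
    (hg : Integrable g ν) : ∫ x, g (f x) ∂μ = ∫ y, g y ∂ν := by
  rw [← hf.map_eq] at hg ⊢
  exact (integral_map hf.aemeasurable hg.aestronglyMeasurable).symm

/-- In fibre coordinates the image point does not involve `τ`, so Fubini integrates `τ` out of the
density alone. The function `G` is arbitrary, to allow `|g|` as well as `g`. -/
theorem integrable_fibreIntegral_mul {X : Fin 3 → EuclideanSpace ℝ (Fin 2)} {α : Fin 3 → ℝ}
    (hX : IsThreeDirectionalMesh X) {G : EuclideanSpace ℝ (Fin 2) → ℂ}
    (hG : Integrable fun t => (coneDensity α t : ℂ) * G (conePoint X t)) :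
    Integrable (fun r : ℝ × ℝ => (fibreIntegral (α 0) (α 1) (α 2) r.1 r.2 : ℂ) *
        G (r.1 • X 0 + r.2 • X 2)) ∧
      ∫ r : ℝ × ℝ, (fibreIntegral (α 0) (α 1) (α 2) r.1 r.2 : ℂ) * G (r.1 • X 0 + r.2 • X 2) =
        ∫ t, (coneDensity α t : ℂ) * G (conePoint X t) := by
  have hmp := measurePreserving_fibreCoordinates
  have hΦ : ∀ z : ℝ × ℝ × ℝ, (coneDensity α (z.1, (z.2.1 + z.1, z.2.2 - z.1)) : ℂ) *
      G (conePoint X (z.1, (z.2.1 + z.1, z.2.2 - z.1))) =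
        ((coneWeight (α 1) z.1 * (coneWeight (α 0) (z.2.1 + z.1) *
          coneWeight (α 2) (z.2.2 - z.1)) : ℝ) : ℂ) * G (z.2.1 • X 0 + z.2.2 • X 2) := by
    intro z
    have : conePoint X (z.1, (z.2.1 + z.1, z.2.2 - z.1)) = z.2.1 • X 0 + z.2.2 • X 2 := by
      simp only [conePoint, hX.third_eq_add]
      module
    rw [this, coneDensity]
  have h1 := hmp.integrable_comp_of_integrable hG
  have h2 := hmp.integral_comp_of_integrable hG
  simp only [Function.comp_def, hΦ] at h1 h2
  have hfib : ∀ r : ℝ × ℝ, ∫ τ, ((coneWeight (α 1) τ * (coneWeight (α 0) (r.1 + τ) *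
      coneWeight (α 2) (r.2 - τ)) : ℝ) : ℂ) * G (r.1 • X 0 + r.2 • X 2) =
        (fibreIntegral (α 0) (α 1) (α 2) r.1 r.2 : ℂ) * G (r.1 • X 0 + r.2 • X 2) := by
    intro r
    rw [integral_mul_const, integral_complex_ofReal, fibreIntegral]
  rw [← h2]
  rw [Measure.volume_eq_prod] at h1
  refine ⟨h1.integral_prod_right.congr (Eventually.of_forall hfib), ?_⟩
  exact (integral_congr_ae (Eventually.of_forall hfib)).symm.trans (integral_prod_symm _ h1).symm

theorem ae_apply_one_ne_zero : ∀ᵐ x : EuclideanSpace ℝ (Fin 2), x 1 ≠ 0 := by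
  have hmp := measurePreserving_planeCoordinates 0 one_ne_zero
  have hr : ∀ᵐ r : ℝ × ℝ, r.1 ≠ 0 := Measure.quasiMeasurePreserving_fst.ae (Measure.ae_ne volume 0)
  filter_upwards [hmp.quasiMeasurePreserving.ae (Measure.ae_smul_measure hr _)] with x hx h
  exact hx (by simp [h])

/-- The cone spline is given by its closed form. -/
theorem integrable_coneFunction_mul {X : Fin 3 → EuclideanSpace ℝ (Fin 2)} {α : Fin 3 → ℝ}
    (hX : IsThreeDirectionalMesh X) (hα : ∀ k, 0 < α k) {G : EuclideanSpace ℝ (Fin 2) → ℂ}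
    (hG : Integrable fun t => (coneDensity α t : ℂ) * G (conePoint X t)) :
    Integrable (fun x => (coneFunction X α x : ℂ) * G x) ∧
      ∫ x, (coneFunction X α x : ℂ) * G x =
        ∫ t, (coneDensity α t : ℂ) * G (conePoint X t) := by
  have hp := hX.apply_zero_one_ne_zero
  obtain ⟨h1, h2⟩ := integrable_fibreIntegral_mul hX hG
  have hmp := measurePreserving_planeCoordinates (X 0 0) hp
  have h1' := h1.smul_measure (c := ENNReal.ofReal |X 0 1|) ENNReal.ofReal_ne_top
  -- The prefactor cancels the Jacobian `|x¹₂|`; the line `x₂ = 0`, where the closed form is not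
  -- compared with the fibre integral, is null.
  have hae : ∀ᵐ x : EuclideanSpace ℝ (Fin 2), ((|X 0 1|⁻¹ : ℝ) : ℂ) *
      ((fibreIntegral (α 0) (α 1) (α 2) (x 1 / X 0 1) (x 0 - X 0 0 / X 0 1 * x 1) : ℂ) *
        G ((x 1 / X 0 1) • X 0 + (x 0 - X 0 0 / X 0 1 * x 1) • X 2)) =
      (coneFunction X α x : ℂ) * G x := by
    filter_upwards [ae_apply_one_ne_zero] with x hx
    have hpt : (x 1 / X 0 1) • X 0 + (x 0 - X 0 0 / X 0 1 * x 1) • X 2 = x := by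
      ext i
      fin_cases i
      · simp [hX.third_eq]
        ring
      · simp [hX.third_eq, hp]
    rw [hpt, coneFunction_eq hX hα hx]
    push_cast
    ring
  refine ⟨((hmp.integrable_comp_of_integrable h1').const_mul _).congr hae, ?_⟩
  rw [← integral_congr_ae hae, integral_const_mul, hmp.integral_comp_of_integrable h1',
    integral_smul_measure, h2, ENNReal.toReal_ofReal (abs_nonneg _), Complex.real_smul, ← mul_assoc,
    ← Complex.ofReal_mul, inv_mul_cancel₀ (abs_ne_zero.2 hp), Complex.ofReal_one, one_mul]

/-! ### The hex spline as a function -/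

theorem MeasureTheory.Integrable.tsum_of_summable_integral_norm {β ι : Type*} [MeasurableSpace β]
    {μ : Measure β} [Countable ι] {F : ι → β → ℂ} (hF : ∀ i, Integrable (F i) μ)
    (hsum : Summable fun i => ∫ x, ‖F i x‖ ∂μ) (hpt : ∀ x, Summable fun i => F i x) :
    Integrable (fun x => ∑' i, F i x) μ := by
  constructor
  · refine aestronglyMeasurable_of_tendsto_ae (u := (atTop : Filter (Finset ι)))
      (f := fun s x => ∑ i ∈ s, F i x) (fun s => ?_) (Eventually.of_forall fun x => (hpt x).hasSum)
    exact Finset.aestronglyMeasurable_fun_sum s fun i _ => (hF i).1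
  · have h1 : ∀ i, ∫⁻ x, ‖F i x‖ₑ ∂μ = ENNReal.ofReal (∫ x, ‖F i x‖ ∂μ) := fun i =>
      (ofReal_integral_norm_eq_lintegral_enorm (hF i)).symm
    calc ∫⁻ x, ‖∑' i, F i x‖ₑ ∂μ ≤ ∫⁻ x, ∑' i, ‖F i x‖ₑ ∂μ :=
          lintegral_mono fun x => enorm_tsum_le_tsum_enorm
      _ = ∑' i, ∫⁻ x, ‖F i x‖ₑ ∂μ := lintegral_tsum fun i => (hF i).1.enorm
      _ < ⊤ := by
        simp only [h1]
        exact hsum.tsum_ofReal_lt_top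

section

variable {X : Fin 3 → EuclideanSpace ℝ (Fin 2)} {α : Fin 3 → ℝ}

theorem coneFunction_nonneg (hX : IsThreeDirectionalMesh X) (hα : ∀ k, 0 < α k)
    {x : EuclideanSpace ℝ (Fin 2)} (hx : x 1 ≠ 0) : 0 ≤ coneFunction X α x := by
  rw [coneFunction_eq hX hα hx]
  refine mul_nonneg (by positivity) (integral_nonneg fun τ => ?_)
  exact mul_nonneg (coneWeight_nonneg (hα 1) _)
    (mul_nonneg (coneWeight_nonneg (hα 0) _) (coneWeight_nonneg (hα 2) _))

/-- The coordinates of a point with respect to `x¹` and `x²`. -/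
theorem coordinates_smul_add_smul (hX : IsThreeDirectionalMesh X) {x : EuclideanSpace ℝ (Fin 2)}
    {a b : ℝ} (hx : x = a • X 0 + b • X 1) :
    a = x 0 - X 0 0 / X 0 1 * x 1 + x 1 / X 0 1 ∧ b = x 0 - X 0 0 / X 0 1 * x 1 := by
  obtain ⟨h0, h1⟩ := hX.snd_eq
  have hp := hX.apply_zero_one_ne_zero
  subst hx
  simp only [PiLp.add_apply, PiLp.smul_apply, smul_eq_mul, h0, h1]
  constructor <;> field_simp <;> ring

/-- The cone spline vanishes outside the cone spanned by `x¹` and `x²`. -/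
theorem coneFunction_support (hX : IsThreeDirectionalMesh X) (hα : ∀ k, 0 < α k)
    {x : EuclideanSpace ℝ (Fin 2)} (hx : coneFunction X α x ≠ 0) :
    0 ≤ x 0 - X 0 0 / X 0 1 * x 1 + x 1 / X 0 1 ∧ 0 ≤ x 0 - X 0 0 / X 0 1 * x 1 := by
  -- The null line cannot be skipped: finiteness is claimed at every point. On it both coordinates
  -- equal `x 0`, and the truncated power decides.
  by_cases h1 : x 1 = 0
  · have h0 : 0 < x 0 := by
      by_contra h
      refine hx ?_
      simp [coneFunction, coneFormula, h1, truncPow, h]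
    simp [h1, h0.le]
  · rw [coneFunction_eq hX hα h1] at hx
    have hfib := right_ne_zero_of_mul hx
    obtain ⟨τ, hτ⟩ : ∃ τ, coneWeight (α 1) τ * (coneWeight (α 0) (x 1 / X 0 1 + τ) *
        coneWeight (α 2) (x 0 - X 0 0 / X 0 1 * x 1 - τ)) ≠ 0 := by
      by_contra! h
      exact hfib (integral_eq_zero_of_ae (Eventually.of_forall h))
    have := pos_of_coneDensity_ne_zero (α := α)
      (t := (τ, x 1 / X 0 1 + τ, x 0 - X 0 0 / X 0 1 * x 1 - τ)) hτ
    simp only at this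
    constructor <;> linarith [this.1, this.2.1, this.2.2]

/-- The coefficient forces `k ≥ 0`, and the support of the translate bounds each `k_i` by a
coordinate of `x` plus `α₃`. -/
theorem finite_support_hexCoeff_mul_coneFunction (hX : IsThreeDirectionalMesh X)
    (hα : ∀ k, 0 < α k) (x : EuclideanSpace ℝ (Fin 2)) :
    {k : ℤ × ℤ | hexCoeff α k * coneFunction X α (x - hexShift X α k) ≠ 0}.Finite := by
  set A := x 0 - X 0 0 / X 0 1 * x 1 + x 1 / X 0 1 with hA
  set B := x 0 - X 0 0 / X 0 1 * x 1 with hB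
  refine (Set.finite_Icc ((0 : ℤ), (0 : ℤ)) (⌊A + α 2⌋, ⌊B + α 2⌋)).subset fun k hk => ?_
  obtain ⟨h1, h2⟩ := nonneg_of_hexCoeff_ne_zero (left_ne_zero_of_mul hk)
  have hs := coneFunction_support hX hα (right_ne_zero_of_mul hk)
  obtain ⟨e1, e2⟩ := coordinates_smul_add_smul hX (x := hexShift X α k) rfl
  simp only [PiLp.sub_apply, mul_sub, sub_div] at hs
  refine ⟨⟨h1, h2⟩, ⟨Int.le_floor.2 ?_, Int.le_floor.2 ?_⟩⟩
  · linarith [hs.1]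
  · linarith [hs.2]

theorem isGivenByFunction_coneSpline (hX : IsThreeDirectionalMesh X) (hα : ∀ k, 0 < α k)
    {C : 𝓢'(EuclideanSpace ℝ (Fin 2), ℂ)} (hC : ∀ g, C g = coneIntegral X α 0 g) :
    IsGivenByFunction C (coneFunction X α) := by
  intro g
  have h := integrable_coneDensity_mul hX hα (zero_mem_shiftedCone X (hα 2).le) g
  simp only [add_zero] at h
  obtain ⟨h1, h2⟩ := integrable_coneFunction_mul hX hα h
  refine ⟨h1, ?_⟩
  rw [h2, hC, coneIntegral]
  simp only [add_zero]

theorem integrable_coneFunction_sub_mul (hX : IsThreeDirectionalMesh X) (hα : ∀ k, 0 < α k)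
    {v : EuclideanSpace ℝ (Fin 2)} (hv : v ∈ shiftedCone X (α 2))
    (g : 𝓢(EuclideanSpace ℝ (Fin 2), ℂ)) :
    Integrable (fun x => (coneFunction X α (x - v) : ℂ) * g x) ∧
      ∫ x, (coneFunction X α (x - v) : ℂ) * g x = coneIntegral X α v g := by
  obtain ⟨h1, h2⟩ := integrable_coneFunction_mul hX hα
    (G := fun y => g (y + v)) (integrable_coneDensity_mul hX hα hv g)
  have h3 := h1.comp_sub_right v
  have h4 := integral_sub_right_eq_self
    (μ := volume) (fun x => (coneFunction X α x : ℂ) * g (x + v)) v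
  simp only [sub_add_cancel] at h3 h4
  exact ⟨h3, h4.trans h2⟩

/-- As the closed form is nonnegative almost everywhere, the change of variables applies with `|g|`
as test function. This makes the `L¹` norms of the hex series summable. -/
theorem integral_norm_coneFunction_sub_mul (hX : IsThreeDirectionalMesh X) (hα : ∀ k, 0 < α k)
    {v : EuclideanSpace ℝ (Fin 2)} (hv : v ∈ shiftedCone X (α 2))
    (g : 𝓢(EuclideanSpace ℝ (Fin 2), ℂ)) :
    ∫ x, ‖(coneFunction X α (x - v) : ℂ) * g x‖ =
      ∫ t, coneDensity α t * ‖g (conePoint X t + v)‖ := by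
  have hi : Integrable fun t => (coneDensity α t : ℂ) * ((‖g (conePoint X t + v)‖ : ℝ) : ℂ) := by
    refine ((integrable_coneDensity_mul_norm hX hα hv g).ofReal (𝕜 := ℂ)).congr
      (Eventually.of_forall fun t => ?_)
    simp
  obtain ⟨-, h2⟩ := integrable_coneFunction_mul hX hα (G := fun y => ((‖g (y + v)‖ : ℝ) : ℂ)) hi
  have h4 := integral_sub_right_eq_self
    (μ := volume) (fun x => ‖(coneFunction X α x : ℂ) * g (x + v)‖) v
  simp only [sub_add_cancel] at h4
  rw [h4]
  have h5 : ∫ x, ‖(coneFunction X α x : ℂ) * g (x + v)‖ =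
      ∫ x, coneFunction X α x * ‖g (x + v)‖ := by
    refine integral_congr_ae ?_
    filter_upwards [ae_apply_one_ne_zero] with x hx
    rw [norm_mul, Complex.norm_real, Real.norm_of_nonneg (coneFunction_nonneg hX hα hx)]
  rw [h5]
  have h6 := h2
  simp only [← Complex.ofReal_mul, integral_complex_ofReal] at h6
  exact_mod_cast h6

theorem isGivenByFunction_hexSpline (hX : IsThreeDirectionalMesh X) (hα : ∀ k, 0 < α k)
    {B : 𝓢'(EuclideanSpace ℝ (Fin 2), ℂ)}
    (hB : ∀ g, B g = ∑' k, (hexCoeff α k : ℂ) * coneIntegral X α (hexShift X α k) g) :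
    IsGivenByFunction B
      (fun x => ∑' k : ℤ × ℤ, hexCoeff α k * coneFunction X α (x - hexShift X α k)) := by
  intro g
  set F : ℤ × ℤ → EuclideanSpace ℝ (Fin 2) → ℂ := fun k x =>
    (hexCoeff α k : ℂ) * ((coneFunction X α (x - hexShift X α k) : ℂ) * g x) with hF
  have hint : ∀ k, Integrable (F k) := by
    intro k
    by_cases h : hexCoeff α k = 0
    · simp [hF, h]
    · exact (integrable_coneFunction_sub_mul hX hα (hexShift_mem_shiftedCone X h) g).1.const_mul _
  have hval : ∀ k, ∫ x, F k x = (hexCoeff α k : ℂ) * coneIntegral X α (hexShift X α k) g := by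
    intro k
    by_cases h : hexCoeff α k = 0
    · simp [hF, h]
    · rw [← (integrable_coneFunction_sub_mul hX hα (hexShift_mem_shiftedCone X h) g).2,
        ← integral_const_mul]
  have hnorm : ∀ k, ∫ x, ‖F k x‖ = |hexCoeff α k| *
      ∫ t, coneDensity α t * ‖g (conePoint X t + hexShift X α k)‖ := by
    intro k
    by_cases h : hexCoeff α k = 0
    · simp [hF, h]
    · rw [← integral_norm_coneFunction_sub_mul hX hα (hexShift_mem_shiftedCone X h) g,
        ← integral_const_mul]
      refine integral_congr_ae (Eventually.of_forall fun x => ?_)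
      beta_reduce
      rw [norm_mul, Complex.norm_real, Real.norm_eq_abs]
  have hsum : Summable fun k => ∫ x, ‖F k x‖ := by
    simp only [hnorm]
    exact summable_hexCoeff_mul_integral_norm hX hα g
  have hfin : ∀ x, (Function.support fun k => hexCoeff α k *
      coneFunction X α (x - hexShift X α k)).Finite :=
    finite_support_hexCoeff_mul_coneFunction hX hα
  have htsum : ∀ x, HasSum (fun k => F k x)
      (((∑' k : ℤ × ℤ, hexCoeff α k * coneFunction X α (x - hexShift X α k) : ℝ) : ℂ) * g x) := by
    intro x
    have hx : Summable fun k => hexCoeff α k * coneFunction X α (x - hexShift X α k) :=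
      summable_of_hasFiniteSupport (hfin x)
    have h := (Complex.hasSum_ofReal.2 hx.hasSum).mul_right (g x)
    refine Eq.mp (congrArg (fun f : ℤ × ℤ → ℂ => HasSum f _) (funext fun k => ?_)) h
    rw [hF, Complex.ofReal_mul, mul_assoc]
  have hi := Integrable.tsum_of_summable_integral_norm hint hsum fun x => (htsum x).summable
  have hv := (hasSum_integral_of_summable_integral_norm hint hsum).tsum_eq
  simp only [hval, (htsum _).tsum_eq] at hi hv
  exact ⟨hi, (hB g).trans hv⟩

end

theorem mainTheorem4 (X : Fin 3 → EuclideanSpace ℝ (Fin 2)) (α : Fin 3 → ℝ)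
    (hX : IsThreeDirectionalMesh X) (hα : ∀ k, 0 < α k) :
    (∃! C, IsFractionalConeSpline X α C) ∧
    (∃! B, IsFractionalHexSpline X α B) ∧
    ∀ C B, IsFractionalConeSpline X α C → IsFractionalHexSpline X α B →
      IsGivenByFunction C (coneFunction X α) ∧
      HasSum (fun k : ℤ × ℤ => (hexCoeff α k : ℂ) • distTranslate (hexShift X α k) C) B ∧
      (∀ x, {k : ℤ × ℤ | hexCoeff α k * coneFunction X α (x - hexShift X α k) ≠ 0}.Finite) ∧
      IsGivenByFunction B
        (fun x => ∑' k : ℤ × ℤ, hexCoeff α k * coneFunction X α (x - hexShift X α k)) := by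
  obtain ⟨C₀, hC₀⟩ := exists_coneSpline hX hα
  obtain ⟨B₀, hB₀⟩ := exists_hexSpline hX hα
  have hC := isFractionalConeSpline_of_eq hX hα hC₀
  have hB := isFractionalHexSpline_of_eq hX hα hB₀
  refine ⟨⟨C₀, hC, fun C h => h.unique hC⟩, ⟨B₀, hB, fun B h => h.unique hB⟩, fun C B h h' => ?_⟩
  obtain rfl : C = C₀ := h.unique hC
  obtain rfl : B = B₀ := h'.unique hB
  exact ⟨isGivenByFunction_coneSpline hX hα hC₀, hasSum_hexSpline hX hα hC₀ hB₀,
    finite_support_hexCoeff_mul_coneFunction hX hα, isGivenByFunction_hexSpline hX hα hB₀⟩
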